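/- Let $(\mathsf C,\mathsf P,\Pi,\mathsf P^\vee,\Pi^\vee)$ be a Cartan datum of finite type with connected Dynkin diagram $\triangle$, vertex set $I$, simple roots $\alpha_i$, simple coroots $h_i$, fundamental weights $\varpi_i$, positive roots $\Phi^+$, Weyl group $\mathsf W=\langle s_i\mid i\in I\rangle$ and longest element $w_0$, and put $\ell=|\Phi^+|=\ell(w_0)$. Let $Q=(\triangle,\xi)$ be a Dynkin quiver, that is, $\xi:I\to\mathbb Z$ satisfies $|\xi_i-\xi_j|=1$ whenever $i,j$ are joined in $\triangle$. A vertex $i$ is a source of $Q$ if $\xi_i>\xi_j$ for all neighbours $j$ of $i$; then $s_iQ$ is the Dynkin quiver with height function $(s_i\xi)_j=\xi_j-2\delta_{ij}$. A word $(i_1,\dots,i_r)$ is $Q$-adapted if $i_k$ is a source of $s_{i_{k-1}}\cdots s_{i_1}Q$ for all $k$. Let $\tau_Q$ be the Coxeter element given by a $Q$-adapted word in which each simple reflection occurs once, and let $\gamma_i^Q=(1-\tau_Q)\varpi_i$. Let $\widehat\triangle$ be the quiver with vertices $\widehat\triangle_0=\{(i,p)\in I\times\mathbb Z\mid p-\xi_i\in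 2\mathbb Z\}$ and with $-\langle h_i,\alpha_j\rangle$ arrows from $(i,p)$ to $(j,p+1)$ whenever $i,j$ are joined in $\triangle$. Let $\phi_Q:\widehat\triangle_0\to\Phi^+\times\mathbb Z$ be defined by $\phi_Q(i,\xi_i)=(\gamma_i^Q,0)$ and, if $\phi_Q(i,p)=(\beta,u)$, by $\phi_Q(i,p\pm2)=(\tau_Q^{\mp1}\beta,u)$ if $\tau_Q^{\mp1}\beta\in\Phi^+$ and $\phi_Q(i,p\pm2)=(-\tau_Q^{\mp1}\beta,u\pm1)$ otherwise. Let $\Gamma_Q$ be the full subquiver of $\widehat\triangle$ with vertex set $(\Gamma_Q)_0=\phi_Q^{-1}(\Phi^+\times\{0\})$. A compatible reading of $(\Gamma_Q)_0$ is a sequence $((i_k,p_k))_k$ whose set of entries is $(\Gamma_Q)_0$ and such that $p_a>p_b$ whenever $a<b$ and $i_a,i_b$ are equal or joined in $\triangle$. For a reduced expression $\underline w_0=s_{i_1}\cdots s_{i_\ell}$ of $w_0$ let $\beta_k^{\underline w_0}=s_{i_1}\cdots s_{i_{k-1}}(\alpha_{i_k})$, and let $\Upsilon_{\underline w_0}$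 be the quiver with vertex set $\Phi^+$ and with $-\langle h_{i_k},\alpha_{i_l}\rangle$ arrows from $\beta_k^{\underline w_0}$ to $\beta_l^{\underline w_0}$ whenever $l<k$, $i_k$ and $i_l$ are joined in $\triangle$, and no $j$ with $l<j<k$ has $i_j\in\{i_k,i_l\}$ (and no other arrows). Then: (i) If $((i_k,p_k))_k$ is a compatible reading of $(\Gamma_Q)_0$, then $\underline w_0=s_{i_1}s_{i_2}\cdots$ is a $Q$-adapted reduced expression of $w_0$, and $\phi_Q(i_k,p_k)=(\beta_k^{\underline w_0},0)$ for all $k$. (ii) Conversely, if $\underline w_0=s_{i_1}\cdots s_{i_\ell}$ is a $Q$-adapted reduced expression of $w_0$ and $p_k=\xi_{i_k}-2\,|\{s\mid 1\le s<k,\ i_s=i_k\}|$, then $((i_k,p_k))_k$ is a compatible reading of $(\Gamma_Q)_0$, and $\phi_Q(i_k,p_k)=(\beta_k^{\underline w_0},0)$ for all $k$. (iii) Thus $((i_k,p_k))_k\mapsto s_{i_1}\cdots s_{i_\ell}$ is a bijection from the compatible readings of $(\Gamma_Q)_0$ onto the $Q$-adapted reduced expressions of $w_0$. (iv) The $Q$-adapted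 reduced expressions of $w_0$ form exactly one commutation class $[Q]$, and $\phi_Q$ induces a quiver isomorphism $\Gamma_Q\cong\Upsilon_{[Q]}$, where $\Upsilon_{[Q]}=\Upsilon_{\underline w_0}$ for any $\underline w_0\in[Q]$; that is, $(i,p)\mapsto\beta$ with $\phi_Q(i,p)=(\beta,0)$ is a bijection $(\Gamma_Q)_0\to\Phi^+$ that preserves the number of arrows between any two vertices. -/

import Mathlib

open Set

noncomputable section

namespace CombAR

/-! A finite Cartan datum is rendered as a finite reduced root datum `D : RootPairing ι ℤ M N`
(weight lattice `M`, coweight lattice `N`) with a base `b`; the index set `I` of the simple roots is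
`b.support`, the simple root `α_i` is `D.root i`, the simple coroot `h_i` is `D.coroot i`, and
`⟨h_i, α_j⟩ = D.pairing j i`. -/

variable {ι M N : Type*} [AddCommGroup M] [AddCommGroup N] {D : RootPairing ι ℤ M N}

/-- The underlying graph of the Dynkin diagram: `i` and `j` are joined by an edge iff
`⟨h_i, α_j⟩ < 0` (this relation is symmetric for a finite Cartan datum). -/
def dynkinGraph (b : D.Base) : SimpleGraph b.support :=
  SimpleGraph.fromRel fun i j => D.pairing j i < 0

/-- The set `Φ⁺` of positive roots, as a subset of the weight lattice. -/
def posRoots (b : D.Base) : Set M := D.root '' {k | b.IsPos k}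

/-- The simple reflection `s_i`, as an automorphism of the weight lattice. -/
def simpleRefl (b : D.Base) (i : b.support) : M ≃ₗ[ℤ] M := D.reflection i

/-- The Weyl group, generated by the simple reflections. -/
def weyl (b : D.Base) : Subgroup (M ≃ₗ[ℤ] M) := Subgroup.closure (range (simpleRefl b))

/-- The product `s_{i_1} ⋯ s_{i_r}` of a word `(i_1, …, i_r)`. -/
def wordProd (b : D.Base) (w : List b.support) : M ≃ₗ[ℤ] M := (w.map (simpleRefl b)).prod

/-- The length `ℓ(g)` of a Weyl group element. -/
def length (b : D.Base) (g : M ≃ₗ[ℤ] M) : ℕ :=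
  sInf {n | ∃ w : List b.support, w.length = n ∧ wordProd b w = g}

/-- `w` is a reduced expression of `g`. -/
def IsReducedExpr (b : D.Base) (g : M ≃ₗ[ℤ] M) (w : List b.support) : Prop :=
  wordProd b w = g ∧ w.length = length b g

/-- `g` is a Weyl group element of the biggest length (there is exactly one, usually written
`w₀`). -/
def IsLongest (b : D.Base) (g : M ≃ₗ[ℤ] M) : Prop :=
  g ∈ weyl b ∧ ∀ u ∈ weyl b, length b u ≤ length b g

/-- The vector `β_k = s_{i_1} ⋯ s_{i_{k-1}} (α_{i_k})` of a word. Positions are counted from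
`0` here, so that `beta b w k` is the one attached to the letter `w[k]`. -/
def beta (b : D.Base) (w : List b.support) (k : Fin w.length) : M :=
  wordProd b (w.take k) (D.root (w.get k))

/-- One commutation move: two neighbouring letters `i, j` that are distinct and not joined in the
Dynkin diagram are exchanged. -/
def CommMove (b : D.Base) (w w' : List b.support) : Prop :=
  ∃ (u v : List b.support) (i j : b.support), i ≠ j ∧ ¬ (dynkinGraph b).Adj i j ∧
    w = u ++ i :: j :: v ∧ w' = u ++ j :: i :: v

/-- `C` is a commutation class of reduced expressions of `g`. -/
def IsCommutationClass (b : D.Base) (g : M ≃ₗ[ℤ] M) (C : Set (List b.support)) : Prop :=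
  ∃ w, IsReducedExpr b g w ∧ C = {w' | Relation.ReflTransGen (CommMove b) w w'}

/-- `i` is a source of the Dynkin quiver with height function `ξ`. -/
def IsSource (b : D.Base) (ξ : b.support → ℤ) (i : b.support) : Prop :=
  ∀ j, (dynkinGraph b).Adj i j → ξ j < ξ i

open Classical in
/-- The height function `s_i ξ`. -/
def fire (b : D.Base) (i : b.support) (ξ : b.support → ℤ) : b.support → ℤ :=
  fun j => ξ j - if i = j then 2 else 0

/-- The word `(i_1, …, i_r)` is adapted to the height function `ξ`: each `i_k` is a source of
`s_{i_{k-1}} ⋯ s_{i_1} ξ`. -/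
def IsAdapted (b : D.Base) : (b.support → ℤ) → List b.support → Prop
  | _, [] => True
  | ξ, i :: w => IsSource b ξ i ∧ IsAdapted b (fire b i ξ) w

/-- A Dynkin quiver `Q`: the Dynkin diagram with a height function. -/
structure DynkinQuiver (b : D.Base) where
  height : b.support → ℤ
  abs_height_sub : ∀ i j, (dynkinGraph b).Adj i j → |height i - height j| = 1

variable {b : D.Base}

theorem isAdapted_of_sorted (Q : DynkinQuiver b) (l : List b.support) (hn : l.Nodup)
    (hs : l.Pairwise fun i j => Q.height j ≤ Q.height i) (ξ : b.support → ℤ)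
    (h1 : ∀ j ∈ l, ξ j = Q.height j) (h2 : ∀ j, j ∉ l → ξ j = Q.height j - 2) :
    IsAdapted b ξ l := by
  induction l generalizing ξ with
  | nil => trivial
  | cons i l ih =>
    rw [List.nodup_cons] at hn
    rw [List.pairwise_cons] at hs
    refine ⟨fun j hj => ?_, ih hn.2 hs.2 _ (fun j hj => ?_) (fun j hj => ?_)⟩
    · have ha := abs_eq (zero_le_one) |>.1 (Q.abs_height_sub i j hj)
      rw [h1 i (by simp)]
      by_cases hm : j ∈ i :: l
      · have hjl : j ∈ l := (List.mem_cons.1 hm).resolve_left fun e => hj.ne e.symm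
        have := hs.1 j hjl
        rw [h1 j hm]
        omega
      · rw [h2 j hm]
        omega
    · have hij : i ≠ j := fun e => hn.1 (e ▸ hj)
      simp [fire, hij, h1 j (List.mem_cons_of_mem _ hj)]
    · by_cases hij : i = j
      · subst hij
        simp [fire, h1 i (by simp)]
      · simp [fire, hij, h2 j (by simp [hj, Ne.symm hij])]

/-- There is a `Q`-adapted word in which every simple reflection occurs exactly once. -/
theorem DynkinQuiver.exists_coxeterWord (Q : DynkinQuiver b) :
    ∃ w : List b.support, w.Nodup ∧ (∀ i, i ∈ w) ∧ IsAdapted b Q.height w := by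
  let l := (Finset.univ : Finset b.support).toList.mergeSort
    fun i j => decide (Q.height j ≤ Q.height i)
  have hp : l.Perm (Finset.univ : Finset b.support).toList := List.mergeSort_perm _ _
  have hn : l.Nodup := hp.nodup_iff.2 (Finset.nodup_toList _)
  have hm : ∀ i, i ∈ l := fun i => hp.mem_iff.2 (by simp)
  have hs : l.Pairwise fun i j => decide (Q.height j ≤ Q.height i) = true :=
    List.pairwise_mergeSort
      (fun a b c hab hbc => by simp only [decide_eq_true_eq] at *; omega)
      (fun a b => by simp only [Bool.or_eq_true, decide_eq_true_eq]; omega) _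
  exact ⟨l, hn, hm, isAdapted_of_sorted Q l hn (hs.imp fun h => by simpa using h) _
    (fun _ _ => rfl) fun j hj => absurd (hm j) hj⟩

namespace DynkinQuiver

variable (Q : DynkinQuiver b)

/-- The Coxeter element `τ_Q` (it does not depend on the choice of the `Q`-adapted word, and every
word in which each simple reflection occurs exactly once is reduced). -/
def coxeter : M ≃ₗ[ℤ] M := wordProd b Q.exists_coxeterWord.choose

/-- `γ_i^Q = (1 - τ_Q) ϖ_i`, where `ϖ` is the family of fundamental weights. -/
def gam (ϖ : b.support → M) (i : b.support) : M := ϖ i - Q.coxeter (ϖ i)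

open Classical in
/-- The step from `φ_Q(i, p)` to `φ_Q(i, p - 2)`. -/
def stepDown (x : M × ℤ) : M × ℤ :=
  if Q.coxeter x.1 ∈ posRoots b then (Q.coxeter x.1, x.2) else (-Q.coxeter x.1, x.2 - 1)

open Classical in
/-- The step from `φ_Q(i, p)` to `φ_Q(i, p + 2)`. -/
def stepUp (x : M × ℤ) : M × ℤ :=
  if Q.coxeter⁻¹ x.1 ∈ posRoots b then (Q.coxeter⁻¹ x.1, x.2) else (-Q.coxeter⁻¹ x.1, x.2 + 1)

/-- The vertices `(i, p)`, `p - ξ_i` even, of the repetition quiver. -/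
def repVertices : Set (b.support × ℤ) := {x | Even (x.2 - Q.height x.1)}

/-- The map `φ_Q` from the vertices of the repetition quiver to `Φ⁺ × ℤ`; it starts with
`φ_Q(i, ξ_i) = (γ_i^Q, 0)` and is continued by `stepDown` and `stepUp`. (Only its values on
`repVertices` are meaningful.) -/
def phi (ϖ : b.support → M) (x : b.support × ℤ) : M × ℤ :=
  match (Q.height x.1 - x.2) / 2 with
  | Int.ofNat n => Q.stepDown^[n] (Q.gam ϖ x.1, 0)
  | Int.negSucc n => Q.stepUp^[n + 1] (Q.gam ϖ x.1, 0)

/-- The vertices of `Γ_Q`, i.e. the preimage of `Φ⁺ × {0}` under `φ_Q`. -/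
def arVertices (ϖ : b.support → M) : Set (b.support × ℤ) :=
  {x | x ∈ Q.repVertices ∧ Q.phi ϖ x ∈ posRoots b ×ˢ ({0} : Set ℤ)}

/-- The sequence `(i_k, p_k)`, `p_k = ξ_{i_k} - 2 |{s < k | i_s = i_k}|`, attached to a word. -/
def coords (w : List b.support) : List (b.support × ℤ) :=
  open Classical in
  List.ofFn fun k : Fin w.length =>
    (w.get k, Q.height (w.get k) - 2 * ((w.take k).count (w.get k) : ℤ))

/-- The set of the `Q`-adapted reduced expressions of `g`. -/
def adaptedExprs (g : M ≃ₗ[ℤ] M) : Set (List b.support) :=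
  {w | IsReducedExpr b g w ∧ IsAdapted b Q.height w}

end DynkinQuiver

/-- The list `L` is a compatible reading of `S`: its entries are exactly the elements of `S`, and
`p_a > p_b` whenever `a < b` and `i_a`, `i_b` are equal or joined in the Dynkin diagram. -/
def IsCompatibleReading (b : D.Base) (S : Set (b.support × ℤ)) (L : List (b.support × ℤ)) : Prop :=
  (∀ x, x ∈ L ↔ x ∈ S) ∧
    L.Pairwise fun x y => (x.1 = y.1 ∨ (dynkinGraph b).Adj x.1 y.1) → y.2 < x.2

/-- The arrows `(i, p) → (j, p + 1)` of the repetition quiver, for `i`, `j` joined in the Dynkin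
diagram; there are `-⟨h_i, α_j⟩` of them. -/
structure RepArrow (b : D.Base) (x y : b.support × ℤ) where
  adj : (dynkinGraph b).Adj x.1 y.1
  snd_eq : y.2 = x.2 + 1
  copy : Fin (-D.pairing y.1 x.1).toNat

/-- The quiver `Γ_Q`: the full subquiver of the repetition quiver on `arVertices`. -/
def Gam (Q : DynkinQuiver b) (ϖ : b.support → M) : Type _ := Q.arVertices ϖ

instance (Q : DynkinQuiver b) (ϖ : b.support → M) : Quiver (Gam Q ϖ) where
  Hom x y := RepArrow b x.1 y.1

/-- The arrows of `Υ_w`: for positions `l < k` such that the letters at `k` and `l` are joined in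
the Dynkin diagram and neither of them occurs strictly in between, there are
`-⟨h_{i_k}, α_{i_l}⟩` arrows from `β_k` to `β_l`. -/
structure UpsArrow (b : D.Base) (w : List b.support) (β γ : M) where
  k : Fin w.length
  l : Fin w.length
  source_eq : beta b w k = β
  target_eq : beta b w l = γ
  lt : l < k
  adj : (dynkinGraph b).Adj (w.get k) (w.get l)
  between : ∀ j, l < j → j < k → w.get j ≠ w.get k ∧ w.get j ≠ w.get l
  copy : Fin (-D.pairing (w.get l) (w.get k)).toNat

/-- The combinatorial AR-quiver `Υ_w` of a reduced expression `w` of the longest element, with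
vertex set `Φ⁺`. -/
def Ups (b : D.Base) (_w : List b.support) : Type _ := posRoots b

instance (b : D.Base) (w : List b.support) : Quiver (Ups b w) where
  Hom β γ := UpsArrow b w β.1 γ.1

/-- An isomorphism of quivers: a bijection on vertices, with bijections on arrows. -/
structure QuiverIso (V W : Type*) [Quiver V] [Quiver W] where
  vertex : V ≃ W
  arrow : ∀ x y : V, (x ⟶ y) ≃ (vertex x ⟶ vertex y)

end CombAR

end

/-! Write `τ` for the Coxeter element, `γ_i` for `Q.gam ϖ i` and `ξ` for the height function of `Q`.
An adapted word is a sequence of source firings, each lowering one value of `ξ` by two. The central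
identity (`wordProd_weight_of_isAdapted`) is that an adapted word `w` acts on `ϖ_i` as `τ ^ c`, with
`c` the number of letters `i` in `w`. Hence the root at the occurrence of `i` preceded by `n` others
is `τ ^ n γ_i` (`beta_of_isAdapted`), the very root reached by `n` downward steps of `phi` while
these roots stay positive.

Let `n_i` (`orbitLength`) be the first `n` with `τ ^ n γ_i` not positive. Then the vertices of `Γ_Q`
are those strictly above `η_i = ξ_i - 2 n_i` and at most `ξ_i` (`arVertices_eq`). The crucial point
is that `η` is again a height function (`isHeight_finalHeight`). It rests on `τ ^ n_j ϖ_j` being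
some `-ϖ_k` modulo vectors orthogonal to all roots: pairing with this vector bounds `n_i` by `n_j`
or `n_j + 1` for joined `i` and `j`.

Once `η` is a height function, combinatorics takes over: `η` is reachable from `ξ` by firing
sources, and compatible readings of the region between them are the same as adapted words from `ξ`
to `η` (`exists_adapted_fires_eq`, `IsCompatibleReading.eq_coordsFrom`). Such a word has only
positive roots `β_k` and makes every simple root negative, so it is a reduced expression of `w₀`.
Conversely, an adapted reduced expression of `w₀` contains exactly `n_i` letters `i`: with another
count, two equal weights `τ ^ c ϖ_i` would differ by a nonempty sum of positive roots. Adapted words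
with equal letter counts differ by commutations, and comparing heights at joined letters identifies
the arrows. -/

set_option linter.unusedSectionVars false

noncomputable section

namespace CombAR

/-! ### Signs of roots, simple reflections, fundamental weights. -/

section RootBasics

variable {ι M N : Type*} [AddCommGroup M] [AddCommGroup N] {D : RootPairing ι ℤ M N}

@[simp] theorem wordProd_nil (b : D.Base) : wordProd b [] = 1 := rfl

@[simp] theorem wordProd_cons (b : D.Base) (i : b.support) (w : List b.support) :
    wordProd b (i :: w) = simpleRefl b i * wordProd b w := by
  simp [wordProd]

theorem wordProd_append (b : D.Base) (u v : List b.support) :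
    wordProd b (u ++ v) = wordProd b u * wordProd b v := by
  simp [wordProd]

theorem simpleRefl_apply (b : D.Base) (i : b.support) (x : M) :
    simpleRefl b i x = x - D.coroot' i x • D.root i := rfl

@[simp] theorem simpleRefl_mul_self (b : D.Base) (i : b.support) :
    simpleRefl b i * simpleRefl b i = 1 := by
  rw [← sq]; exact D.reflection_sq i

@[simp] theorem simpleRefl_simpleRefl (b : D.Base) (i : b.support) (x : M) :
    simpleRefl b i (simpleRefl b i x) = x := D.reflection_same i x

@[simp] theorem simpleRefl_inv (b : D.Base) (i : b.support) :
    (simpleRefl b i)⁻¹ = simpleRefl b i := D.reflection_inv i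

@[simp] theorem simpleRefl_root_self (b : D.Base) (i : b.support) :
    simpleRefl b i (D.root i) = -D.root i := D.reflection_apply_self i

theorem wordProd_inv (b : D.Base) (w : List b.support) :
    (wordProd b w)⁻¹ = wordProd b w.reverse := by
  induction w with
  | nil => simp
  | cons i w ih => simp [wordProd_append, ih]

theorem wordProd_mem_weyl (b : D.Base) (w : List b.support) : wordProd b w ∈ weyl b := by
  induction w with
  | nil => exact one_mem _
  | cons i w ih =>
    rw [wordProd_cons]
    exact mul_mem (Subgroup.subset_closure (mem_range_self i)) ih

theorem exists_word_of_mem_weyl (b : D.Base) {g : M ≃ₗ[ℤ] M} (hg : g ∈ weyl b) :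
    ∃ w, wordProd b w = g := by
  induction hg using Subgroup.closure_induction with
  | mem x hx => obtain ⟨i, rfl⟩ := hx; exact ⟨[i], by simp⟩
  | one => exact ⟨[], rfl⟩
  | mul x y _ _ hx hy =>
    obtain ⟨u, rfl⟩ := hx
    obtain ⟨v, rfl⟩ := hy
    exact ⟨u ++ v, wordProd_append b u v⟩
  | inv x _ hx =>
    obtain ⟨u, rfl⟩ := hx
    exact ⟨u.reverse, (wordProd_inv b u).symm⟩

/-- A Weyl group element permutes the roots and conjugates the reflections accordingly. -/
theorem exists_root_wordProd (b : D.Base) (w : List b.support) (k : ι) :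
    ∃ l, D.root l = wordProd b w (D.root k) ∧
      D.reflection l = wordProd b w * D.reflection k * (wordProd b w)⁻¹ := by
  induction w with
  | nil => exact ⟨k, by simp⟩
  | cons i w ih =>
    obtain ⟨l, h1, h2⟩ := ih
    refine ⟨D.reflectionPerm i l, ?_, ?_⟩
    · rw [D.root_reflectionPerm, h1]; rfl
    · rw [D.reflection_reflectionPerm, h2, wordProd_cons, mul_inv_rev, simpleRefl_inv]
      simp only [simpleRefl, mul_assoc]

theorem wordProd_mem_range_root (b : D.Base) (w : List b.support) {x : M}
    (hx : x ∈ range D.root) : wordProd b w x ∈ range D.root := by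
  obtain ⟨k, rfl⟩ := hx
  obtain ⟨l, h, -⟩ := exists_root_wordProd b w k
  exact ⟨l, h⟩

theorem mem_range_root_of_pos {b : D.Base} {x : M} (hx : x ∈ posRoots b) : x ∈ range D.root := by
  obtain ⟨k, -, rfl⟩ := hx
  exact ⟨k, rfl⟩

theorem pos_or_neg (b : D.Base) {x : M} (hx : x ∈ range D.root) :
    x ∈ posRoots b ∨ -x ∈ posRoots b := by
  let := D.indexNeg
  obtain ⟨k, rfl⟩ := hx
  rcases RootPairing.Base.IsPos.or_neg b k with h | h
  · exact Or.inl ⟨k, h, rfl⟩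
  · exact Or.inr ⟨-k, h, by simp⟩

theorem neg_notMem_of_pos {b : D.Base} {x : M} (hx : x ∈ posRoots b) : -x ∉ posRoots b := by
  let := D.indexNeg
  rintro ⟨l, hl, h⟩
  obtain ⟨k, hk, rfl⟩ := hx
  have : l = -k := D.root.injective (by simp [h])
  subst this
  exact (RootPairing.Base.IsPos.neg_iff_not b k).1 hl hk

theorem neg_mem_iff_notMem (b : D.Base) {x : M} (hx : x ∈ range D.root) :
    -x ∈ posRoots b ↔ x ∉ posRoots b :=
  ⟨fun h h' => neg_notMem_of_pos h' h, fun h => (pos_or_neg b hx).resolve_left h⟩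

theorem simpleRoot_pos (b : D.Base) (i : b.support) : D.root i ∈ posRoots b :=
  ⟨i, b.isPos_of_mem_support i.2, rfl⟩

theorem simpleRefl_pos [Finite ι] [D.IsReduced] (b : D.Base) (i : b.support) {x : M}
    (hx : x ∈ posRoots b) (hne : x ≠ D.root i) : simpleRefl b i x ∈ posRoots b := by
  obtain ⟨k, hk, rfl⟩ := hx
  exact ⟨D.reflectionPerm i k, hk.reflectionPerm i.2 (fun h => hne (by rw [h])),
    D.root_reflectionPerm i k⟩

theorem eq_root_of_simpleRefl_neg [Finite ι] [D.IsReduced] (b : D.Base) (i : b.support) {x : M}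
    (hx : x ∈ posRoots b) (hn : simpleRefl b i x ∉ posRoots b) : x = D.root i := by
  by_contra h
  exact hn (simpleRefl_pos b i hx h)

theorem pairingIn_int (D : RootPairing ι ℤ M N) (i j : ι) : D.pairingIn ℤ i j = D.pairing i j := by
  simpa using D.algebraMap_pairingIn ℤ i j

theorem coroot'_root_nonpos [Finite ι] (b : D.Base) {i j : b.support} (h : i ≠ j) :
    D.coroot' i (D.root j) ≤ 0 := by
  have := b.pairingIn_le_zero_of_ne (i := j) (j := i)
    (fun e => h (Subtype.ext e.symm)) j.2 i.2
  rwa [pairingIn_int] at this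

theorem pairing_neg_of_adj [Finite ι] (b : D.Base) {i j : b.support}
    (h : (dynkinGraph b).Adj i j) : D.pairing i j < 0 := by
  rw [dynkinGraph, SimpleGraph.fromRel_adj] at h
  have := D.pairingIn_lt_zero_iff ℤ (i := i) (j := j)
  simp only [pairingIn_int] at this
  tauto

theorem pairing_eq_zero_of_not_adj [Finite ι] (b : D.Base) {i j : b.support} (hne : i ≠ j)
    (h : ¬ (dynkinGraph b).Adj i j) : D.pairing i j = 0 := by
  rw [dynkinGraph, SimpleGraph.fromRel_adj] at h
  have := coroot'_root_nonpos b hne.symm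
  rw [D.root_coroot'_eq_pairing] at this
  push Not at h
  exact le_antisymm this (h hne).2

theorem simpleRefl_comm [Finite ι] (b : D.Base) {i j : b.support} (hne : i ≠ j)
    (h : ¬ (dynkinGraph b).Adj i j) :
    simpleRefl b i * simpleRefl b j = simpleRefl b j * simpleRefl b i := by
  have h1 := pairing_eq_zero_of_not_adj b hne h
  have h2 := pairing_eq_zero_of_not_adj b hne.symm (fun h' => h h'.symm)
  ext x
  simp only [LinearEquiv.mul_apply, simpleRefl_apply, map_sub, map_smul,
    D.root_coroot'_eq_pairing, h1, h2, zero_smul, sub_zero]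
  abel

/-- `M` may contain nonzero vectors killed by every coroot. Several identities below hold only up to
such vectors, and this is the test for being one. -/
theorem coroot'_eq_zero_of_simple (b : D.Base) {z : M} (hz : ∀ i : b.support, D.coroot' i z = 0)
    (k : ι) : D.coroot' k z = 0 := by
  have := b.coroot_mem_span_int k
  change D.toLinearMap z (D.coroot k) = 0
  generalize D.coroot k = y at this ⊢
  induction this using Submodule.span_induction with
  | mem x hx => obtain ⟨i, hi, rfl⟩ := hx; exact hz ⟨i, hi⟩
  | zero => simp
  | add x y _ _ hx hy => simp [hx, hy]
  | smul a x _ hx => simp [hx]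

/-- `ϖ` is a family of fundamental weights. -/
structure IsFundamental (b : D.Base) (ϖ : b.support → M) : Prop where
  same : ∀ i : b.support, D.coroot' i (ϖ i) = 1
  ne : ∀ i j : b.support, i ≠ j → D.coroot' j (ϖ i) = 0

variable {b : D.Base} {ϖ : b.support → M}

namespace IsFundamental

theorem simpleRefl_self (h : IsFundamental b ϖ) (i : b.support) :
    simpleRefl b i (ϖ i) = ϖ i - D.root i := by
  rw [simpleRefl_apply, h.same, one_smul]

theorem simpleRefl_ne (h : IsFundamental b ϖ) {i j : b.support} (hij : i ≠ j) :
    simpleRefl b i (ϖ j) = ϖ j := by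
  rw [simpleRefl_apply, h.ne j i hij.symm, zero_smul, sub_zero]

theorem wordProd_of_notMem (h : IsFundamental b ϖ) {w : List b.support} {j : b.support}
    (hj : j ∉ w) : wordProd b w (ϖ j) = ϖ j := by
  induction w with
  | nil => rfl
  | cons i w ih =>
    rw [List.mem_cons, not_or] at hj
    rw [wordProd_cons, LinearEquiv.mul_apply, ih hj.2, h.simpleRefl_ne (Ne.symm hj.1)]

end IsFundamental

theorem wordProd_apply_of_coroot'_eq_zero (w : List b.support) {z : M}
    (hz : ∀ k, D.coroot' k z = 0) : wordProd b w z = z := by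
  induction w with
  | nil => rfl
  | cons i w ih => rw [wordProd_cons, LinearEquiv.mul_apply, ih, simpleRefl_apply, hz, zero_smul,
      sub_zero]

theorem exists_eq_sum_of_pos {x : M} (hx : x ∈ posRoots b) :
    ∃ f : ι → ℕ, x = ∑ j ∈ b.support, f j • D.root j := by
  obtain ⟨k, hk, rfl⟩ := hx
  obtain ⟨f, -, hf | hf⟩ := b.exists_root_eq_sum_nat_or_neg k
  · exact ⟨f, hf⟩
  · exfalso
    have : D.root k = ∑ j ∈ b.support, (-(f j : ℤ)) • D.root j := by simp [hf]
    have h1 := RootPairing.Base.height_eq_sum this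
    rw [mem_ofPred_eq, RootPairing.Base.isPos_iff, h1] at hk
    exact absurd hk (not_lt.2 (Finset.sum_nonpos fun i _ => by simp))

theorem apply_nonneg_of_pos (φ : M →ₗ[ℤ] ℤ) (hφ : ∀ i : b.support, 0 ≤ φ (D.root i)) {x : M}
    (hx : x ∈ posRoots b) : 0 ≤ φ x := by
  obtain ⟨f, rfl⟩ := exists_eq_sum_of_pos hx
  rw [map_sum]
  refine Finset.sum_nonneg fun i hi => ?_
  rw [map_nsmul]
  exact nsmul_nonneg (hφ ⟨i, hi⟩) _

end RootBasics

/-! ### The invariant form and sign tests against fundamental weights. -/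

section Form

variable {ι M N : Type*} [Finite ι] [AddCommGroup M] [AddCommGroup N]

/-- The canonical Weyl-invariant form on the weight lattice. -/
def bil (D : RootPairing ι ℤ M N) : LinearMap.BilinForm ℤ M :=
  letI := Fintype.ofFinite ι
  D.RootForm

variable {D : RootPairing ι ℤ M N}

theorem bil_comm (x y : M) : bil D x y = bil D y x := by
  let := Fintype.ofFinite ι
  simp only [bil, D.rootForm_apply_apply, mul_comm]

theorem bil_wordProd (b : D.Base) (w : List b.support) (x y : M) :
    bil D (wordProd b w x) (wordProd b w y) = bil D x y := by
  let := Fintype.ofFinite ι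
  induction w with
  | nil => rfl
  | cons i w ih =>
    rw [← ih, wordProd_cons]
    exact D.rootForm_reflection_reflection_apply i _ _

theorem two_mul_bil_root (k : ι) (x : M) :
    2 * bil D (D.root k) x = bil D (D.root k) (D.root k) * D.coroot' k x := by
  let := Fintype.ofFinite ι
  have h := congrArg (fun n => D.toLinearMap x n) (D.rootForm_self_smul_coroot k)
  rw [map_smul, two_smul, map_add, D.toLinearMap_apply_apply_Polarization, ← two_mul] at h
  exact h.symm

theorem bil_root_self_pos (k : ι) : 0 < bil D (D.root k) (D.root k) := by
  let := Fintype.ofFinite ι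
  rw [bil, D.rootForm_root_self]
  refine Finset.sum_pos' (fun i _ => mul_self_nonneg _) ⟨k, Finset.mem_univ _, by simp⟩

theorem bil_eq_zero_of_coroot'_eq_zero {z : M} (hz : ∀ k, D.coroot' k z = 0) (x : M) :
    bil D x z = 0 := by
  let := Fintype.ofFinite ι
  simp [bil, D.rootForm_apply_apply, hz]

variable {b : D.Base} {ϖ : b.support → M}

namespace IsFundamental

theorem bil_simple_self (h : IsFundamental b ϖ) (i : b.support) :
    0 < bil D (D.root i) (ϖ i) := by
  have := two_mul_bil_root (D := D) i (ϖ i)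
  rw [h.same] at this
  have := bil_root_self_pos (D := D) i
  omega

theorem bil_simple_ne (h : IsFundamental b ϖ) {i j : b.support} (hij : i ≠ j) :
    bil D (D.root i) (ϖ j) = 0 := by
  have := two_mul_bil_root (D := D) i (ϖ j)
  rw [h.ne j i hij.symm] at this
  omega

theorem bil_simple_nonneg (h : IsFundamental b ϖ) (i j : b.support) :
    0 ≤ bil D (D.root i) (ϖ j) := by
  by_cases hij : i = j
  · subst hij; exact (h.bil_simple_self i).le
  · exact (h.bil_simple_ne hij).ge

theorem bil_nonneg_of_pos (h : IsFundamental b ϖ) {x : M} (hx : x ∈ posRoots b)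
    (j : b.support) : 0 ≤ bil D x (ϖ j) :=
  apply_nonneg_of_pos ((bil D).flip (ϖ j)) (fun i => h.bil_simple_nonneg i j) hx

theorem exists_bil_pos (h : IsFundamental b ϖ) {x : M} (hx : x ∈ posRoots b) :
    ∃ j, 0 < bil D x (ϖ j) := by
  by_contra! hc
  have h0 : ∀ j, bil D x (ϖ j) = 0 := fun j => le_antisymm (hc j) (h.bil_nonneg_of_pos hx j)
  obtain ⟨k, hk, rfl⟩ := hx
  obtain ⟨f, hs, hf⟩ := b.exists_root_eq_sum_int k
  have : ∀ j ∈ b.support, f j = 0 := fun j hj => by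
    have := h0 ⟨j, hj⟩
    rw [hf.2, map_sum, LinearMap.sum_apply, Finset.sum_eq_single_of_mem j hj] at this
    · simp only [map_smul, LinearMap.smul_apply, smul_eq_mul, mul_eq_zero] at this
      exact this.resolve_right (h.bil_simple_self ⟨j, hj⟩).ne'
    · intro i hi hij
      have := h.bil_simple_ne (i := ⟨i, hi⟩) (j := ⟨j, hj⟩) (by simpa using hij)
      simp only [map_smul, LinearMap.smul_apply, this, smul_zero]
  apply D.ne_zero k
  rw [hf.2]
  exact Finset.sum_eq_zero fun j hj => by rw [this j hj, zero_smul]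

/-- The simple-root coefficients of a root share one sign, and pairing with `ϖ j` reads off a
positive multiple of the coefficient at `j`. One pairing thus decides positivity. -/
theorem pos_of_bil_pos (h : IsFundamental b ϖ) {x : M} (hx : x ∈ range D.root) {j : b.support}
    (hj : 0 < bil D x (ϖ j)) : x ∈ posRoots b := by
  refine (pos_or_neg b hx).resolve_right fun hn => ?_
  have := h.bil_nonneg_of_pos hn j
  rw [map_neg, LinearMap.neg_apply] at this
  omega

theorem notMem_of_bil_neg (h : IsFundamental b ϖ) {x : M} {j : b.support}
    (hj : bil D x (ϖ j) < 0) : x ∉ posRoots b := fun hx =>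
  absurd (h.bil_nonneg_of_pos hx j) (not_le.2 hj)

end IsFundamental

/-- The action of a Weyl group element on `x` is determined by its values on the fundamental
weights that occur in `x`. -/
theorem IsFundamental.wordProd_apply_eq (h : IsFundamental b ϖ) (u v : List b.support) {x : M}
    (hx : ∀ j : b.support, D.coroot' j x ≠ 0 → wordProd b u (ϖ j) = wordProd b v (ϖ j)) :
    wordProd b u x = wordProd b v x := by
  classical
  set y : M := ∑ j : b.support, D.coroot' j x • ϖ j with hy
  have hz : ∀ k, D.coroot' k (x - y) = 0 := by
    refine coroot'_eq_zero_of_simple b fun i => ?_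
    rw [map_sub, hy, map_sum, Finset.sum_eq_single i]
    · simp [h.same]
    · intro j _ hj
      simp [h.ne j i hj]
    · simp
  have hxy : x = (x - y) + y := by abel
  rw [hxy, map_add, map_add, wordProd_apply_of_coroot'_eq_zero _ hz,
    wordProd_apply_of_coroot'_eq_zero _ hz, hy, map_sum, map_sum]
  congr 1
  refine Finset.sum_congr rfl fun j _ => ?_
  rw [map_smul, map_smul]
  by_cases hj : D.coroot' j x = 0
  · rw [hj, zero_smul, zero_smul]
  · rw [hx j hj]

end Form

/-! ### Inversions, the exchange property and the longest element. -/

section Length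

variable {ι M N : Type*} [Finite ι] [AddCommGroup M] [AddCommGroup N] {D : RootPairing ι ℤ M N}
  {b : D.Base}

theorem weyl_apply_mem_range_root {g : M ≃ₗ[ℤ] M} (hg : g ∈ weyl b) {x : M}
    (hx : x ∈ range D.root) : g x ∈ range D.root := by
  obtain ⟨w, rfl⟩ := exists_word_of_mem_weyl b hg
  exact wordProd_mem_range_root b w hx

theorem simpleRefl_mem_weyl (b : D.Base) (i : b.support) : simpleRefl b i ∈ weyl b :=
  Subgroup.subset_closure (mem_range_self i)

/-- The positive roots that `g` does not send to positive roots. -/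
def inversions (b : D.Base) (g : M ≃ₗ[ℤ] M) : Set M := {x ∈ posRoots b | g x ∉ posRoots b}

theorem inversions_finite (b : D.Base) (g : M ≃ₗ[ℤ] M) : (inversions b g).Finite :=
  (finite_range D.root).subset fun _ hx => mem_range_root_of_pos hx.1

theorem inversions_one (b : D.Base) : inversions b (1 : M ≃ₗ[ℤ] M) = ∅ :=
  eq_empty_of_forall_notMem fun _ hx => hx.2 hx.1

variable [D.IsReduced]

/-- A simple reflection permutes the positive roots other than its own, so only that root can be a
new inversion. -/
theorem inversions_mul_simpleRefl {g : M ≃ₗ[ℤ] M} {i : b.support}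
    (hi : g (D.root i) ∈ posRoots b) :
    inversions b (g * simpleRefl b i) = insert (D.root i) (simpleRefl b i '' inversions b g) := by
  have hne : ∀ y ∈ inversions b g, y ≠ D.root i := fun y hy e => hy.2 (e ▸ hi)
  ext x
  constructor
  · rintro ⟨hx, hgx⟩
    by_cases hxi : x = D.root i
    · exact Or.inl hxi
    · exact Or.inr ⟨simpleRefl b i x, ⟨simpleRefl_pos b i hx hxi, hgx⟩,
        simpleRefl_simpleRefl b i x⟩
  · rintro (rfl | ⟨y, hy, rfl⟩)
    · refine ⟨simpleRoot_pos b i, ?_⟩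
      rw [LinearEquiv.mul_apply, simpleRefl_root_self, map_neg]
      exact neg_notMem_of_pos hi
    · refine ⟨simpleRefl_pos b i hy.1 (hne y hy), ?_⟩
      rw [LinearEquiv.mul_apply, simpleRefl_simpleRefl]
      exact hy.2

theorem ncard_inversions_mul_simpleRefl {g : M ≃ₗ[ℤ] M} {i : b.support}
    (hi : g (D.root i) ∈ posRoots b) :
    (inversions b (g * simpleRefl b i)).ncard = (inversions b g).ncard + 1 := by
  rw [inversions_mul_simpleRefl hi, ncard_insert_of_notMem _ ((inversions_finite b g).image _),
    ncard_image_of_injective _ (simpleRefl b i).injective]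
  rintro ⟨y, hy, h⟩
  have : y = -D.root i := by rw [← simpleRefl_simpleRefl b i y, h, simpleRefl_root_self]
  exact neg_notMem_of_pos (simpleRoot_pos b i) (this ▸ hy.1)

/-- All the vectors `β_k` of the word `w` are positive roots. -/
def AllBetaPos (b : D.Base) (w : List b.support) : Prop :=
  ∀ (u : List b.support) (i : b.support) (v : List b.support), w = u ++ i :: v → wordProd b u (D.root i) ∈ posRoots b

theorem allBetaPos_nil (b : D.Base) : AllBetaPos b [] := fun u i v h => by simp at h

theorem AllBetaPos.of_append {u v : List b.support} (h : AllBetaPos b (u ++ v)) :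
    AllBetaPos b u := fun u' i v' e => h u' i (v' ++ v) (by simp [e])

theorem allBetaPos_concat {w : List b.support} {i : b.support} :
    AllBetaPos b (w ++ [i]) ↔ AllBetaPos b w ∧ wordProd b w (D.root i) ∈ posRoots b := by
  refine ⟨fun h => ⟨h.of_append, h w i [] rfl⟩, fun h u j v e => ?_⟩
  rcases List.eq_nil_or_concat v with rfl | ⟨v', k, rfl⟩
  · obtain ⟨rfl, h'⟩ := List.append_inj' e rfl
    obtain rfl : i = j := by simpa using h'
    exact h.2
  · rw [List.concat_eq_append, ← List.cons_append, ← List.append_assoc] at e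
    exact h.1 u j v' (List.append_inj' e rfl).1

/-- Each letter changes the number of inversions by one, upwards exactly when its root `β` is
positive. A single downward step leaves a deficit that later letters cannot make up. -/
theorem ncard_inversions_wordProd_le (w : List b.support) :
    (inversions b (wordProd b w)).ncard ≤ w.length ∧
      (AllBetaPos b w ↔ (inversions b (wordProd b w)).ncard = w.length) := by
  induction w using List.reverseRecOn with
  | nil => simp [inversions_one, allBetaPos_nil]
  | append_singleton w i ih =>
    rw [allBetaPos_concat, wordProd_append, List.length_append, ih.2]
    have hw := wordProd_mem_weyl b w
    simp only [wordProd_cons, wordProd_nil, mul_one, List.length_singleton]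
    by_cases hi : wordProd b w (D.root i) ∈ posRoots b
    · rw [ncard_inversions_mul_simpleRefl hi]
      simp only [hi, and_true]
      omega
    · have h1 : (wordProd b w * simpleRefl b i) (D.root i) ∈ posRoots b := by
        rw [LinearEquiv.mul_apply, simpleRefl_root_self, map_neg]
        exact (neg_mem_iff_notMem b (wordProd_mem_range_root b w ⟨i, rfl⟩)).2 hi
      have h2 := ncard_inversions_mul_simpleRefl h1
      rw [mul_assoc, simpleRefl_mul_self, mul_one] at h2
      simp only [hi, and_false, false_iff]
      omega

/-- The exchange property. -/
theorem exists_shorter_word (u : List b.support) {i : b.support}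
    (h : wordProd b u (D.root i) ∉ posRoots b) :
    ∃ u', u'.length + 1 = u.length ∧ wordProd b u' = wordProd b u * simpleRefl b i := by
  induction u with
  | nil => exact absurd (simpleRoot_pos b i) h
  | cons j u ih =>
    by_cases hu : wordProd b u (D.root i) ∈ posRoots b
    · have he := eq_root_of_simpleRefl_neg b j hu h
      obtain ⟨l, h1, h2⟩ := exists_root_wordProd b u i
      obtain rfl : l = j := D.root.injective (h1.trans he)
      refine ⟨u, rfl, ?_⟩
      have h3 : wordProd b u * simpleRefl b i = simpleRefl b j * wordProd b u := by
        change _ = D.reflection j * _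
        rw [h2, inv_mul_cancel_right]; rfl
      rw [wordProd_cons, mul_assoc, h3, ← mul_assoc, simpleRefl_mul_self, one_mul]
    · obtain ⟨u', h1, h2⟩ := ih hu
      exact ⟨j :: u', by simp [h1], by rw [wordProd_cons, wordProd_cons, h2, mul_assoc]⟩

theorem exists_reducedExpr {g : M ≃ₗ[ℤ] M} (hg : g ∈ weyl b) : ∃ w, IsReducedExpr b g w := by
  obtain ⟨w, hw⟩ := exists_word_of_mem_weyl b hg
  obtain ⟨w', h1, h2⟩ := Nat.sInf_mem (s := {n | ∃ w : List b.support, w.length = n ∧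
    wordProd b w = g}) ⟨_, w, rfl, hw⟩
  exact ⟨w', h2, h1⟩

theorem length_wordProd_le (w : List b.support) : length b (wordProd b w) ≤ w.length :=
  Nat.sInf_le ⟨w, rfl, rfl⟩

theorem IsReducedExpr.allBetaPos {g : M ≃ₗ[ℤ] M} {w : List b.support}
    (h : IsReducedExpr b g w) : AllBetaPos b w := by
  rintro u i v rfl
  by_contra hn
  obtain ⟨u', h1, h2⟩ := exists_shorter_word u hn
  have h3 := length_wordProd_le (u' ++ v)
  rw [wordProd_append, h2] at h3
  have h4 := h.2
  rw [← h.1, wordProd_append, wordProd_cons, ← mul_assoc] at h4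
  rw [← h4] at h3
  simp only [List.length_append, List.length_cons] at h3
  omega

theorem length_eq_ncard_inversions {g : M ≃ₗ[ℤ] M} (hg : g ∈ weyl b) :
    length b g = (inversions b g).ncard := by
  obtain ⟨w, hw⟩ := exists_reducedExpr hg
  rw [← hw.2, ← hw.1, (ncard_inversions_wordProd_le w).2.1 hw.allBetaPos]

theorem isReducedExpr_iff {g : M ≃ₗ[ℤ] M} {w : List b.support} :
    IsReducedExpr b g w ↔ wordProd b w = g ∧ AllBetaPos b w := by
  refine ⟨fun h => ⟨h.1, h.allBetaPos⟩, ?_⟩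
  rintro ⟨rfl, h⟩
  exact ⟨rfl, by rw [length_eq_ncard_inversions (wordProd_mem_weyl b w),
    (ncard_inversions_wordProd_le w).2.1 h]⟩

theorem eq_one_of_inversions_eq_empty {g : M ≃ₗ[ℤ] M} (hg : g ∈ weyl b)
    (h : inversions b g = ∅) : g = 1 := by
  obtain ⟨w, hw⟩ := exists_reducedExpr hg
  have := hw.2
  rw [length_eq_ncard_inversions hg, h, ncard_empty, List.length_eq_zero_iff] at this
  subst this
  exact hw.1.symm

theorem IsLongest.apply_simpleRoot {g : M ≃ₗ[ℤ] M} (h : IsLongest b g) (i : b.support) :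
    g (D.root i) ∉ posRoots b := fun hi => by
  have h1 := mul_mem h.1 (simpleRefl_mem_weyl b i)
  have := h.2 _ h1
  rw [length_eq_ncard_inversions h1, length_eq_ncard_inversions h.1,
    ncard_inversions_mul_simpleRefl hi] at this
  omega

theorem apply_notMem_of_pos {ϖ : b.support → M} (hϖ : IsFundamental b ϖ) {g : M ≃ₗ[ℤ] M}
    (hg : g ∈ weyl b) (h : ∀ i : b.support, g (D.root i) ∉ posRoots b) {x : M}
    (hx : x ∈ posRoots b) : g x ∉ posRoots b := fun hgx => by
  obtain ⟨j, hj⟩ := hϖ.exists_bil_pos hgx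
  have := apply_nonneg_of_pos (-((bil D).flip (ϖ j) ∘ₗ g.toLinearMap)) (fun i => ?_) hx
  · simp at this; omega
  · have := hϖ.bil_nonneg_of_pos ((neg_mem_iff_notMem b
      (weyl_apply_mem_range_root hg ⟨i, rfl⟩)).2 (h i)) j
    simpa using this

/-- Both elements make all positive roots negative, so `w₀⁻¹ * g` has no inversions. -/
theorem IsLongest.eq_of_apply_notMem {ϖ : b.support → M} (hϖ : IsFundamental b ϖ)
    {w₀ g : M ≃ₗ[ℤ] M} (h₀ : IsLongest b w₀) (hg : g ∈ weyl b)
    (h : ∀ i : b.support, g (D.root i) ∉ posRoots b) : g = w₀ := by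
  have h1 := mul_mem (inv_mem h₀.1) hg
  have : w₀⁻¹ * g = 1 := by
    refine eq_one_of_inversions_eq_empty h1 (eq_empty_of_forall_notMem fun x hx => ?_)
    have h2 := (neg_mem_iff_notMem b (weyl_apply_mem_range_root h1 (mem_range_root_of_pos hx.1))).2
      hx.2
    have h3 := apply_notMem_of_pos hϖ h₀.1 h₀.apply_simpleRoot h2
    rw [map_neg, ← LinearEquiv.mul_apply, mul_inv_cancel_left] at h3
    exact h3 ((neg_mem_iff_notMem b (weyl_apply_mem_range_root hg
      (mem_range_root_of_pos hx.1))).2 (apply_notMem_of_pos hϖ hg h hx.1))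
  exact (inv_mul_eq_one.1 this).symm

/-- Along the prefixes of `w`, the inverse images of `x` start positive and end non-positive. At a
change of sign the root must be the simple root of the letter just read. -/
theorem exists_beta_eq {w : List b.support} {x : M} (hx : x ∈ posRoots b)
    (h : (wordProd b w)⁻¹ x ∉ posRoots b) :
    ∃ (u : List b.support) (i : b.support) (v : List b.support), w = u ++ i :: v ∧ wordProd b u (D.root i) = x := by
  induction w using List.reverseRecOn with
  | nil => exact absurd hx h
  | append_singleton w i ih =>
    by_cases hw : (wordProd b w)⁻¹ x ∈ posRoots b
    · rw [wordProd_append, mul_inv_rev] at h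
      simp only [wordProd_cons, wordProd_nil, mul_one, simpleRefl_inv] at h
      refine ⟨w, i, [], rfl, ?_⟩
      rw [← eq_root_of_simpleRefl_neg b i hw h, ← LinearEquiv.mul_apply, mul_inv_cancel]
      rfl
    · obtain ⟨u, j, v, rfl, e⟩ := ih hw
      exact ⟨u, j, v ++ [i], by simp, e⟩

theorem AllBetaPos.inv_apply_beta_notMem {u v : List b.support} {i : b.support}
    (h : AllBetaPos b (u ++ i :: v)) :
    (wordProd b (u ++ i :: v))⁻¹ (wordProd b u (D.root i)) ∉ posRoots b := by
  induction v using List.reverseRecOn with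
  | nil =>
    rw [wordProd_append, mul_inv_rev, LinearEquiv.mul_apply,
      ← LinearEquiv.mul_apply (wordProd b u)⁻¹, inv_mul_cancel]
    simpa using neg_notMem_of_pos (simpleRoot_pos b i)
  | append_singleton v k ih =>
    rw [← List.cons_append, ← List.append_assoc] at h ⊢
    have h1 := ih h.of_append
    have hr := weyl_apply_mem_range_root (inv_mem (wordProd_mem_weyl b (u ++ i :: v)))
      (wordProd_mem_range_root b u ⟨i, rfl⟩)
    have h2 := (neg_mem_iff_notMem b hr).2 h1
    intro hn
    have h3 : simpleRefl b k (-((wordProd b (u ++ i :: v))⁻¹ (wordProd b u (D.root i)))) ∉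
        posRoots b := by
      rw [map_neg]
      refine neg_notMem_of_pos ?_
      rw [wordProd_append _ (u ++ i :: v), mul_inv_rev] at hn
      simpa using hn
    have h4 := eq_root_of_simpleRefl_neg b k h2 h3
    have h5 := (allBetaPos_concat.1 h).2
    rw [← h4, map_neg, ← LinearEquiv.mul_apply, mul_inv_cancel] at h5
    exact neg_notMem_of_pos (h u i (v ++ [k]) (by simp)) h5

theorem AllBetaPos.beta_ne {u v t : List b.support} {i j : b.support}
    (h : AllBetaPos b (u ++ i :: v ++ j :: t)) :
    wordProd b (u ++ i :: v) (D.root j) ≠ wordProd b u (D.root i) := fun e => by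
  have := h.of_append.inv_apply_beta_notMem
  rw [← e, ← LinearEquiv.mul_apply, inv_mul_cancel] at this
  exact this (simpleRoot_pos b j)

end Length

/-! ### Combinatorics of height functions, adapted words and readings. -/

section Adapted

open scoped Classical

variable {ι M N : Type*} [Finite ι] [AddCommGroup M] [AddCommGroup N] {D : RootPairing ι ℤ M N}
  {b : D.Base}

/-- The height function obtained by firing the letters of a word one after the other. -/
def fires (b : D.Base) (ξ : b.support → ℤ) (w : List b.support) : b.support → ℤ :=
  w.foldl (fun ξ i => fire b i ξ) ξ

@[simp] theorem fires_nil (ξ : b.support → ℤ) : fires b ξ [] = ξ := rfl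

@[simp] theorem fires_cons (ξ : b.support → ℤ) (i : b.support) (w : List b.support) :
    fires b ξ (i :: w) = fires b (fire b i ξ) w := rfl

theorem fires_append (ξ : b.support → ℤ) (u v : List b.support) :
    fires b ξ (u ++ v) = fires b (fires b ξ u) v := List.foldl_append

theorem fire_apply (ξ : b.support → ℤ) (i j : b.support) :
    fire b i ξ j = ξ j - if i = j then 2 else 0 := rfl

theorem fires_apply (ξ : b.support → ℤ) (w : List b.support) (j : b.support) :
    fires b ξ w j = ξ j - 2 * (w.count j : ℤ) := by
  induction w generalizing ξ with
  | nil => simp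
  | cons i w ih =>
    rw [fires_cons, ih, fire_apply, List.count_cons]
    by_cases h : i = j
    · subst h; simp; ring
    · simp [h]

theorem fires_of_notMem (ξ : b.support → ℤ) {w : List b.support} {j : b.support} (h : j ∉ w) :
    fires b ξ w j = ξ j := by
  rw [fires_apply, List.count_eq_zero_of_not_mem h]; simp

theorem fires_le (ξ : b.support → ℤ) (w : List b.support) (j : b.support) :
    fires b ξ w j ≤ ξ j := by
  rw [fires_apply]; omega

theorem isAdapted_append {ξ : b.support → ℤ} {u v : List b.support} :
    IsAdapted b ξ (u ++ v) ↔ IsAdapted b ξ u ∧ IsAdapted b (fires b ξ u) v := by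
  induction u generalizing ξ with
  | nil => simp [IsAdapted]
  | cons i u ih => simp only [List.cons_append, IsAdapted, ih, fires_cons, and_assoc]

/-- Height functions: values at joined vertices differ by one. -/
def IsHeight (b : D.Base) (ξ : b.support → ℤ) : Prop :=
  ∀ i j, (dynkinGraph b).Adj i j → |ξ i - ξ j| = 1

theorem IsHeight.fire {ξ : b.support → ℤ} (h : IsHeight b ξ) {i : b.support}
    (hi : IsSource b ξ i) : IsHeight b (fire b i ξ) := by
  intro j k hjk
  have h1 := (abs_eq zero_le_one).1 (h j k hjk)
  rw [abs_eq zero_le_one, fire_apply, fire_apply]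
  by_cases hj : i = j
  · subst hj
    have := hi k hjk
    rw [if_pos rfl, if_neg hjk.ne]
    omega
  · by_cases hk : i = k
    · subst hk
      have := hi j hjk.symm
      rw [if_neg hj, if_pos rfl]
      omega
    · rw [if_neg hj, if_neg hk]; omega

theorem IsHeight.fires {ξ : b.support → ℤ} (h : IsHeight b ξ) {w : List b.support}
    (hw : IsAdapted b ξ w) : IsHeight b (fires b ξ w) := by
  induction w generalizing ξ with
  | nil => exact h
  | cons i w ih => exact ih (h.fire hw.1) hw.2

/-- A height function is reached from every bigger one of the same parity by firing sources. -/
theorem exists_adapted_fires_eq {ξ η : b.support → ℤ} (hξ : IsHeight b ξ) (hη : IsHeight b η)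
    (hle : ∀ i, η i ≤ ξ i) (heven : ∀ i, Even (ξ i - η i)) :
    ∃ w, IsAdapted b ξ w ∧ fires b ξ w = η := by
  induction hn : ∑ i, (ξ i - η i).toNat using Nat.strong_induction_on generalizing ξ with
  | _ n ih =>
    by_cases he : ξ = η
    · exact ⟨[], trivial, he⟩
    obtain ⟨i₀, hi₀⟩ : ∃ i, η i < ξ i := by
      by_contra! hc
      exact he (funext fun i => le_antisymm (hc i) (hle i))
    -- The highest vertex not yet at its final height is a source: a higher neighbour `j` would
    -- satisfy `η j = ξ j = ξ i + 1 ≥ η i + 3`, against `hη`.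
    obtain ⟨i, hi, hmax⟩ := Finset.exists_max_image (Finset.univ.filter fun i => η i < ξ i) ξ
      ⟨i₀, by simpa using hi₀⟩
    simp only [Finset.mem_filter, Finset.mem_univ, true_and] at hi hmax
    have h2 : η i + 2 ≤ ξ i := by
      obtain ⟨c, hc⟩ := heven i
      omega
    have hsrc : IsSource b ξ i := fun j hj => by
      have h1 := (abs_eq zero_le_one).1 (hξ i j hj)
      have h3 := (abs_eq zero_le_one).1 (hη i j hj)
      by_cases hj' : η j < ξ j
      · have := hmax j hj'
        omega
      · omega
    have hf : ∀ j, fire b i ξ j = ξ j - if i = j then 2 else 0 := fun j => rfl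
    obtain ⟨w, hw, e⟩ := ih (∑ j, (fire b i ξ j - η j).toNat) (by
        rw [← hn]
        refine Finset.sum_lt_sum (fun j _ => ?_) ⟨i, Finset.mem_univ _, ?_⟩
        · rw [hf]; split_ifs <;> omega
        · rw [hf, if_pos rfl]; omega) (hξ.fire hsrc) (fun j => by
        rw [hf]
        split_ifs with h
        · subst h; omega
        · have := hle j; omega) (fun j => by
        rw [hf]
        have := heven j
        split_ifs with h
        · rw [sub_right_comm]; exact this.sub even_two
        · simpa using this) rfl
    exact ⟨i :: w, ⟨hsrc, hw⟩, e⟩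

theorem commMove_symm {w w' : List b.support} (h : CommMove b w w') : CommMove b w' w := by
  obtain ⟨u, v, i, j, h1, h2, rfl, rfl⟩ := h
  exact ⟨u, v, j, i, h1.symm, fun h => h2 h.symm, rfl, rfl⟩

theorem CommMove.cons {w w' : List b.support} (h : CommMove b w w') (k : b.support) :
    CommMove b (k :: w) (k :: w') := by
  obtain ⟨u, v, i, j, h1, h2, rfl, rfl⟩ := h
  exact ⟨k :: u, v, i, j, h1, h2, rfl, rfl⟩

theorem CommMove.wordProd_eq {w w' : List b.support} (h : CommMove b w w') :
    wordProd b w' = wordProd b w := by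
  obtain ⟨u, v, i, j, h1, h2, rfl, rfl⟩ := h
  simp only [wordProd_append, wordProd_cons, ← mul_assoc]
  rw [mul_assoc (wordProd b u), ← simpleRefl_comm b h1 h2, ← mul_assoc]

theorem CommMove.length_eq {w w' : List b.support} (h : CommMove b w w') :
    w'.length = w.length := by
  obtain ⟨u, v, i, j, -, -, rfl, rfl⟩ := h
  simp

theorem fire_comm (ξ : b.support → ℤ) (i j : b.support) :
    fire b i (fire b j ξ) = fire b j (fire b i ξ) := by
  funext k
  simp only [fire_apply]
  ring

theorem isSource_fire {ξ : b.support → ℤ} {i j : b.support} (hne : i ≠ j)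
    (h : ¬ (dynkinGraph b).Adj i j) : IsSource b (fire b i ξ) j ↔ IsSource b ξ j := by
  refine forall_congr' fun k => forall_congr' fun hk => ?_
  have : i ≠ k := fun e => h (e ▸ hk.symm)
  simp [fire_apply, hne, this]

theorem CommMove.isAdapted {ξ : b.support → ℤ} {w w' : List b.support} (h : CommMove b w w')
    (hw : IsAdapted b ξ w) : IsAdapted b ξ w' := by
  obtain ⟨u, v, i, j, h1, h2, rfl, rfl⟩ := h
  rw [isAdapted_append] at hw ⊢
  obtain ⟨hu, hi, hj, hv⟩ := hw
  refine ⟨hu, (isSource_fire h1 h2).1 hj, ?_, ?_⟩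
  · exact (isSource_fire h1.symm fun h => h2 h.symm).2 hi
  · rwa [fire_comm]

theorem commMoves_to_front {u v : List b.support} {i : b.support}
    (h : ∀ k ∈ u, i ≠ k ∧ ¬ (dynkinGraph b).Adj i k) :
    Relation.ReflTransGen (CommMove b) (i :: (u ++ v)) (u ++ i :: v) := by
  induction u with
  | nil => exact .refl
  | cons k u ih =>
    have h1 := h k (by simp)
    refine .head ⟨[], u ++ v, i, k, h1.1, h1.2, rfl, rfl⟩ ?_
    exact (ih fun l hl => h l (by simp [hl])).lift (k :: ·) fun _ _ h => h.cons k

/-- Adapted words with the same letters are connected by commutation moves. -/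
theorem commMoves_of_perm {ξ : b.support → ℤ} {w w' : List b.support} (hw : IsAdapted b ξ w)
    (hw' : IsAdapted b ξ w') (hp : w.Perm w') : Relation.ReflTransGen (CommMove b) w w' := by
  induction w generalizing ξ w' with
  | nil => rw [List.nil_perm.1 hp]
  | cons i w ih =>
    obtain ⟨u, v, rfl, hu⟩ := List.eq_append_cons_of_mem (hp.mem_iff.1 List.mem_cons_self)
    -- `i` is a source at the start, so a neighbour `k` begins below it. Firing only lowers `k`,
    -- which therefore cannot be a source before `i` is fired.
    have hk : ∀ k ∈ u, i ≠ k ∧ ¬ (dynkinGraph b).Adj i k := by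
      intro k hk
      refine ⟨fun e => hu (e ▸ hk), fun hadj => ?_⟩
      obtain ⟨u₁, u₂, rfl⟩ := List.append_of_mem hk
      rw [List.append_assoc, List.cons_append, isAdapted_append] at hw'
      have h1 := hw'.2.1 i hadj.symm
      rw [fires_of_notMem ξ fun h => hu (by simp [h])] at h1
      have := hw.1 k hadj
      have := fires_le ξ u₁ k
      omega
    have hm := commMoves_to_front (v := v) hk
    have ha : IsAdapted b ξ (i :: (u ++ v)) := by
      have h2 : ∀ w, Relation.ReflTransGen (CommMove b) w (u ++ i :: v) → IsAdapted b ξ w := by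
        intro w h
        induction h using Relation.ReflTransGen.head_induction_on with
        | refl => exact hw'
        | head h3 _ h4 => exact (commMove_symm h3).isAdapted h4
      exact h2 _ hm
    refine .trans ((ih hw.2 ha.2 ?_).lift (i :: ·) fun _ _ h => h.cons i) hm
    exact (hp.trans List.perm_middle).cons_inv

/-- The vertices `(i, p)` with `η_i < p ≤ ξ_i` and `p ≡ ξ_i` modulo two. -/
def between (b : D.Base) (ξ η : b.support → ℤ) : Set (b.support × ℤ) :=
  {x | η x.1 < x.2 ∧ x.2 ≤ ξ x.1 ∧ Even (ξ x.1 - x.2)}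

theorem mem_between {ξ η : b.support → ℤ} {x : b.support × ℤ} :
    x ∈ between b ξ η ↔ η x.1 < x.2 ∧ x.2 ≤ ξ x.1 ∧ Even (ξ x.1 - x.2) := Iff.rfl

theorem mem_between_fire {ξ η : b.support → ℤ} {i : b.support} {x : b.support × ℤ}
    (hi : η i < ξ i) :
    x ∈ between b ξ η ↔ x = (i, ξ i) ∨ x ∈ between b (fire b i ξ) η := by
  obtain ⟨j, p⟩ := x
  simp only [mem_between, fire_apply, Prod.mk.injEq]
  by_cases h : i = j
  · subst h
    simp only [if_true, true_and, Int.even_iff]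
    omega
  · simp [h, Ne.symm h]

theorem notMem_between_fire {ξ η : b.support → ℤ} {i : b.support} :
    (i, ξ i) ∉ between b (fire b i ξ) η := by
  simp [mem_between, fire_apply]

/-- The sequence `(i_k, p_k)` attached to a word, computed recursively. -/
def coordsFrom (b : D.Base) : (b.support → ℤ) → List b.support → List (b.support × ℤ)
  | _, [] => []
  | ξ, i :: w => (i, ξ i) :: coordsFrom b (fire b i ξ) w

@[simp] theorem length_coordsFrom (ξ : b.support → ℤ) (w : List b.support) :
    (coordsFrom b ξ w).length = w.length := by
  induction w generalizing ξ with
  | nil => rfl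
  | cons i w ih => simp [coordsFrom, ih]

theorem map_fst_coordsFrom (ξ : b.support → ℤ) (w : List b.support) :
    (coordsFrom b ξ w).map Prod.fst = w := by
  induction w generalizing ξ with
  | nil => rfl
  | cons i w ih => simp [coordsFrom, ih]

theorem getElem_coordsFrom (ξ : b.support → ℤ) (w : List b.support) (k : ℕ)
    (hk : k < w.length) :
    (coordsFrom b ξ w)[k]'(by simpa using hk) = (w[k], fires b ξ (w.take k) w[k]) := by
  induction w generalizing ξ k with
  | nil => simp at hk
  | cons i w ih =>
    cases k with
    | zero => rfl
    | succ k => simpa [coordsFrom] using ih (fire b i ξ) k (by simpa using hk)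

theorem coords_eq (Q : DynkinQuiver b) (w : List b.support) :
    Q.coords w = coordsFrom b Q.height w := by
  refine List.ext_getElem (by simp [DynkinQuiver.coords]) fun k h1 h2 => ?_
  rw [getElem_coordsFrom _ _ _ (by simpa using h2), fires_apply]
  simp [DynkinQuiver.coords]

theorem isCompatibleReading_coordsFrom {ξ : b.support → ℤ} {w : List b.support}
    (hw : IsAdapted b ξ w) :
    IsCompatibleReading b (between b ξ (fires b ξ w)) (coordsFrom b ξ w) := by
  induction w generalizing ξ with
  | nil =>
    refine ⟨fun x => ?_, List.Pairwise.nil⟩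
    simp only [coordsFrom, List.not_mem_nil, fires_nil, mem_between, false_iff]
    omega
  | cons i w ih =>
    obtain ⟨h1, h2⟩ := ih hw.2
    refine ⟨fun x => ?_, List.pairwise_cons.2 ⟨fun y hy hxy => ?_, h2⟩⟩
    · have hlt : fires b ξ (i :: w) i < ξ i := by
        rw [fires_apply]; simp
      rw [mem_between_fire hlt, fires_cons, ← h1 x, coordsFrom, List.mem_cons]
    · have h3 := ((h1 y).1 hy).2.1
      rw [fire_apply] at h3
      rcases hxy with h | h
      · simp only at h
        rw [if_pos h, ← h] at h3
        simp only; omega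
      · have := hw.1 _ h
        simp only at h ⊢
        rw [if_neg h.ne] at h3
        omega

/-- The first entry of a reading must be a source `i` at its top value `ξ i`. Removing it leaves a
reading of the region below `fire b i ξ`, so the letters determine the list. -/
theorem IsCompatibleReading.eq_coordsFrom {ξ η : b.support → ℤ} (hη : IsHeight b η)
    (hle : ∀ i, η i ≤ ξ i) (heven : ∀ i, Even (ξ i - η i)) {L : List (b.support × ℤ)}
    (hL : IsCompatibleReading b (between b ξ η) L) :
    IsAdapted b ξ (L.map Prod.fst) ∧ fires b ξ (L.map Prod.fst) = η ∧
      coordsFrom b ξ (L.map Prod.fst) = L := by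
  induction L generalizing ξ with
  | nil =>
    refine ⟨trivial, funext fun i => ?_, rfl⟩
    have := (hL.1 (i, ξ i)).not.1 (by simp)
    simp only [mem_between, le_refl, sub_self, Even.zero, and_true, not_lt] at this
    exact le_antisymm this (hle i)
  | cons x L ih =>
    obtain ⟨i, p⟩ := x
    obtain ⟨hm, hp⟩ := hL
    obtain ⟨hp1, hp2⟩ := List.pairwise_cons.1 hp
    have hx := (hm (i, p)).1 (by simp)
    simp only [mem_between] at hx
    have hlt : η i < ξ i := by omega
    have hpe : p = ξ i := by
      by_contra hne
      have h1 := (hm (i, ξ i)).2 (by simpa [mem_between] using hlt)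
      rcases List.mem_cons.1 h1 with h | h
      · exact hne (by simpa using h.symm)
      · have := hp1 _ h (Or.inl rfl)
        simp only at this
        omega
    subst hpe
    have hsrc : IsSource b ξ i := fun j hj => by
      by_cases hj' : η j < ξ j
      · have h1 := (hm (j, ξ j)).2 (by simpa [mem_between] using hj')
        rcases List.mem_cons.1 h1 with h | h
        · exact absurd (congrArg Prod.fst h).symm hj.ne
        · exact hp1 _ h (Or.inr hj)
      -- Here `j` is exhausted, `ξ j = η j ≤ η i + 1`, while parity gives `η i + 2 ≤ ξ i`.
      · have h3 := (abs_eq zero_le_one).1 (hη i j hj)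
        have h4 := hle j
        have h5 := heven i
        rw [Int.even_iff] at h5
        omega
    have hnot : (i, ξ i) ∉ L := fun h => absurd (hp1 _ h (Or.inl rfl)) (lt_irrefl _)
    have hread : IsCompatibleReading b (between b (fire b i ξ) η) L := by
      refine ⟨fun y => ?_, hp2⟩
      have h1 := hm y
      rw [mem_between_fire hlt, List.mem_cons] at h1
      constructor
      · intro hy
        exact (h1.1 (Or.inr hy)).resolve_left fun e => hnot (e ▸ hy)
      · intro hy
        exact (h1.2 (Or.inr hy)).resolve_left fun e => notMem_between_fire (e ▸ hy)
    have h2 := heven i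
    obtain ⟨h3, h4, h5⟩ := ih (ξ := fire b i ξ) (fun j => by
        rw [fire_apply]
        split_ifs with h
        · subst h; rw [Int.even_iff] at h2; omega
        · have := hle j; omega) (fun j => by
        rw [fire_apply, sub_right_comm]
        split_ifs with h
        · exact (heven j).sub even_two
        · simpa using heven j) hread
    exact ⟨⟨hsrc, h3⟩, h4, by simp [coordsFrom, h5]⟩

end Adapted

/-! ### The Coxeter element and its orbits on roots and weights. -/

section Coxeter

open scoped Classical

variable {ι M N : Type*} [Finite ι] [AddCommGroup M] [AddCommGroup N] {D : RootPairing ι ℤ M N}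
  {b : D.Base} {ϖ : b.support → M}

theorem bil_weyl {g : M ≃ₗ[ℤ] M} (hg : g ∈ weyl b) (x y : M) :
    bil D (g x) (g y) = bil D x y := by
  obtain ⟨w, rfl⟩ := exists_word_of_mem_weyl b hg
  exact bil_wordProd b w x y

theorem IsFundamental.weyl_apply_eq (h : IsFundamental b ϖ) {f g : M ≃ₗ[ℤ] M} (hf : f ∈ weyl b)
    (hg : g ∈ weyl b) {x : M}
    (hx : ∀ j : b.support, D.coroot' j x ≠ 0 → f (ϖ j) = g (ϖ j)) : f x = g x := by
  obtain ⟨u, rfl⟩ := exists_word_of_mem_weyl b hf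
  obtain ⟨v, rfl⟩ := exists_word_of_mem_weyl b hg
  exact h.wordProd_apply_eq u v hx

/-- Behind this is that `v` adds to `α_i` a nonnegative combination of the `α_l`, `l ∈ v`. The
induction needs `φ` general: it is also used for the coroot of the first letter, to see that the
added coefficient is nonnegative. -/
theorem apply_wordProd_le (v : List b.support) (hv : v.Nodup) {i : b.support} (hi : i ∉ v)
    (φ : M →ₗ[ℤ] ℤ) (hφ : ∀ l ∈ v, φ (D.root l) ≤ 0) :
    φ (wordProd b v (D.root i)) ≤ φ (D.root i) := by
  induction v generalizing φ with
  | nil => exact le_rfl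
  | cons k v ih =>
    rw [List.nodup_cons] at hv
    rw [List.mem_cons, not_or] at hi
    have h1 := ih hv.2 hi.2 φ fun l hl => hφ l (by simp [hl])
    have h2 := ih hv.2 hi.2 (D.coroot' k) fun l hl =>
      coroot'_root_nonpos b (by rintro rfl; exact hv.1 hl)
    have h3 := coroot'_root_nonpos b (Ne.symm hi.1)
    rw [wordProd_cons, LinearEquiv.mul_apply, simpleRefl_apply, map_sub, map_smul, smul_eq_mul]
    have h4 := hφ k (by simp)
    have := mul_nonneg_of_nonpos_of_nonpos (h2.trans h3) h4
    omega

theorem bil_root_nonpos {i j : b.support} (h : i ≠ j) :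
    bil D (D.root i) (D.root j) ≤ 0 := by
  have h1 := two_mul_bil_root (D := D) i (D.root j)
  have h2 := mul_nonpos_of_nonneg_of_nonpos (bil_root_self_pos (D := D) i).le
    (coroot'_root_nonpos b h)
  omega

theorem bil_root_neg {i j : b.support} (h : (dynkinGraph b).Adj i j) :
    bil D (D.root i) (D.root j) < 0 := by
  have h1 := two_mul_bil_root (D := D) i (D.root j)
  rw [D.root_coroot'_eq_pairing] at h1
  have h2 := mul_neg_of_pos_of_neg (bil_root_self_pos (D := D) i) (pairing_neg_of_adj b h.symm)
  omega

theorem IsFundamental.wordProd_pos (h : IsFundamental b ϖ) {v : List b.support} (hv : v.Nodup)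
    {i : b.support} (hi : i ∉ v) : wordProd b v (D.root i) ∈ posRoots b := by
  refine h.pos_of_bil_pos (j := i) (wordProd_mem_range_root b v ⟨i, rfl⟩) ?_
  have h1 := apply_wordProd_le v hv hi (-(bil D).flip (ϖ i)) fun l _ => by
    simpa using h.bil_simple_nonneg l i
  simp only [LinearMap.neg_apply, neg_le_neg_iff] at h1
  exact (h.bil_simple_self i).trans_le h1

theorem bil_wordProd_right (w : List b.support) (x y : M) :
    bil D (wordProd b w x) y = bil D x (wordProd b w.reverse y) := by
  rw [← wordProd_inv, ← bil_wordProd b w x, ← LinearEquiv.mul_apply, mul_inv_cancel]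
  rfl

theorem IsFundamental.bil_wordProd_of_notMem (h : IsFundamental b ϖ) {w : List b.support}
    {j : b.support} (hj : j ∉ w) (x : M) : bil D (wordProd b w x) (ϖ j) = bil D x (ϖ j) := by
  rw [bil_wordProd_right, h.wordProd_of_notMem (by simpa using hj)]

/-- When the letter `j` is applied, the vector pairs negatively with `α_j` because of the neighbour
`i`, so `α_j` enters with a positive coefficient. The other letters leave that coefficient alone. -/
theorem IsFundamental.bil_wordProd_pos_of_adj (h : IsFundamental b ϖ) {v : List b.support}
    (hv : v.Nodup) {i j : b.support} (hi : i ∉ v) (hj : j ∈ v) (hij : (dynkinGraph b).Adj i j) :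
    0 < bil D (wordProd b v (D.root i)) (ϖ j) := by
  obtain ⟨u, t, rfl⟩ := List.append_of_mem hj
  have hju : j ∉ u := fun hm => (List.nodup_append.1 hv).2.2 j hm j (by simp) rfl
  have hv' := List.nodup_cons.1 (List.nodup_append.1 hv).2.1
  simp only [List.mem_append, List.mem_cons, not_or] at hi
  rw [wordProd_append, LinearEquiv.mul_apply, h.bil_wordProd_of_notMem hju, wordProd_cons,
    LinearEquiv.mul_apply]
  have h1 : bil D (simpleRefl b j (wordProd b t (D.root i))) (ϖ j) =
      bil D (wordProd b t (D.root i)) (simpleRefl b j (ϖ j)) := by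
    simpa using bil_wordProd_right [j] (wordProd b t (D.root i)) (ϖ j)
  rw [h1, h.simpleRefl_self, map_sub]
  have h2 : bil D (wordProd b t (D.root i)) (D.root j) ≤ bil D (D.root i) (D.root j) :=
    apply_wordProd_le t hv'.2 hi.2.2 ((bil D).flip (D.root j)) fun l hl => by
    simpa using bil_root_nonpos (b := b) (i := l) (j := j) (by rintro rfl; exact hv'.1 hl)
  have h3 := h.bil_wordProd_of_notMem hv'.1 (D.root i)
  have h4 := h.bil_simple_nonneg i j
  have h5 := bil_root_neg hij
  omega

/-- A vector fixed by a product of distinct simple reflections is fixed by all of them. -/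
theorem IsFundamental.coroot'_eq_zero_of_fixed (h : IsFundamental b ϖ) {w : List b.support}
    (hw : w.Nodup) {z : M} (hz : wordProd b w z = z) : ∀ i ∈ w, D.coroot' i z = 0 := by
  induction w with
  | nil => simp
  | cons i w ih =>
    rw [List.nodup_cons] at hw
    have h1 : wordProd b w z = simpleRefl b i z := by
      rw [← simpleRefl_simpleRefl b i (wordProd b w z)]
      exact congrArg _ hz
    have h2 : D.coroot' i z = 0 := by
      -- The remaining word does not contain `i` and preserves the pairing with `ϖ i`, whereas `s_i`
      -- shifts it by `⟨h_i, z⟩` times a positive number.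
      have := h.bil_wordProd_of_notMem hw.1 z
      rw [h1, simpleRefl_apply, map_sub, map_smul, LinearMap.sub_apply, LinearMap.smul_apply,
        smul_eq_mul, sub_eq_self, mul_eq_zero] at this
      exact this.resolve_right (h.bil_simple_self i).ne'
    intro j hj
    rcases List.mem_cons.1 hj with rfl | hj
    · exact h2
    · refine ih hw.2 ?_ j hj
      rw [h1, simpleRefl_apply, h2, zero_smul, sub_zero]

namespace DynkinQuiver

variable (Q : DynkinQuiver b)

/-- The chosen adapted word in which each letter occurs once. -/
def coxeterWord : List b.support := Q.exists_coxeterWord.choose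

theorem coxeterWord_nodup : Q.coxeterWord.Nodup := Q.exists_coxeterWord.choose_spec.1

theorem mem_coxeterWord (i : b.support) : i ∈ Q.coxeterWord :=
  Q.exists_coxeterWord.choose_spec.2.1 i

theorem isAdapted_coxeterWord : IsAdapted b Q.height Q.coxeterWord :=
  Q.exists_coxeterWord.choose_spec.2.2

theorem coxeter_eq : Q.coxeter = wordProd b Q.coxeterWord := rfl

theorem coxeter_pow_mem (n : ℕ) : Q.coxeter ^ n ∈ weyl b :=
  pow_mem (wordProd_mem_weyl b _) n

variable {Q}

theorem notMem_of_coxeterWord_eq {u v : List b.support} {i : b.support}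
    (h : Q.coxeterWord = u ++ i :: v) : i ∉ u ∧ i ∉ v ∧ (v ++ u).Nodup := by
  have hn := Q.coxeterWord_nodup
  rw [h] at hn
  obtain ⟨h1, h2, h3⟩ := List.nodup_append.1 hn
  rw [List.nodup_cons] at h2
  exact ⟨fun hm => h3 i hm i (by simp) rfl, h2.1, List.nodup_append.2 ⟨h2.2, h1,
    fun a ha c hc e => h3 c hc a (by simp [ha]) e.symm⟩⟩

theorem mem_left_of_coxeterWord_eq {u v : List b.support} {i j : b.support}
    (h : Q.coxeterWord = u ++ i :: v) (hij : (dynkinGraph b).Adj i j)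
    (hlt : Q.height i < Q.height j) : j ∈ u := by
  by_contra hj
  have ha := Q.isAdapted_coxeterWord
  rw [h, isAdapted_append] at ha
  have := ha.2.1 j hij
  rw [fires_of_notMem _ hj, fires_of_notMem _ (notMem_of_coxeterWord_eq h).1] at this
  omega

theorem mem_right_of_coxeterWord_eq {u v : List b.support} {i j : b.support}
    (h : Q.coxeterWord = u ++ i :: v) (hij : (dynkinGraph b).Adj i j)
    (hlt : Q.height j < Q.height i) : j ∈ v := by
  have hj := Q.mem_coxeterWord j
  rw [h, List.mem_append, List.mem_cons] at hj
  rcases hj with hj | rfl | hj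
  · obtain ⟨s, t, rfl⟩ := List.append_of_mem hj
    have := mem_left_of_coxeterWord_eq (u := s) (v := t ++ i :: v) (i := j) (j := i)
      (by simp [h]) hij.symm hlt
    exact absurd (by simp [this]) (notMem_of_coxeterWord_eq h).1
  · exact absurd rfl hij.ne
  · exact hj

theorem coxeter_apply_of_mem_left (hϖ : IsFundamental b ϖ) {u v : List b.support}
    {i j : b.support} (h : Q.coxeterWord = u ++ i :: v) (hj : j ∈ u) :
    Q.coxeter (ϖ j) = wordProd b u (ϖ j) := by
  obtain ⟨h1, h2, h3⟩ := notMem_of_coxeterWord_eq h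
  rw [coxeter_eq, h, wordProd_append, LinearEquiv.mul_apply, hϖ.wordProd_of_notMem]
  rw [List.mem_cons, not_or]
  exact ⟨fun e => h1 (e ▸ hj), fun hv => (List.nodup_append.1 h3).2.2 j hv j hj rfl⟩

theorem gam_eq_wordProd (hϖ : IsFundamental b ϖ) {u v : List b.support} {i : b.support}
    (h : Q.coxeterWord = u ++ i :: v) : Q.gam ϖ i = wordProd b u (D.root i) := by
  obtain ⟨h1, h2, -⟩ := notMem_of_coxeterWord_eq h
  rw [gam, coxeter_eq, h, wordProd_append, wordProd_cons, LinearEquiv.mul_apply,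
    LinearEquiv.mul_apply, hϖ.wordProd_of_notMem h2, hϖ.simpleRefl_self, map_sub,
    hϖ.wordProd_of_notMem h1, sub_sub_cancel]

theorem exists_coxeterWord_eq (Q : DynkinQuiver b) (i : b.support) :
    ∃ u v, Q.coxeterWord = u ++ i :: v :=
  List.append_of_mem (Q.mem_coxeterWord i)

theorem gam_pos (hϖ : IsFundamental b ϖ) (i : b.support) : Q.gam ϖ i ∈ posRoots b := by
  obtain ⟨u, v, h⟩ := Q.exists_coxeterWord_eq i
  obtain ⟨h1, -, h3⟩ := notMem_of_coxeterWord_eq h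
  rw [gam_eq_wordProd hϖ h]
  exact hϖ.wordProd_pos (List.nodup_append.1 h3).2.1 h1

theorem coxeter_inv_gam_notMem (hϖ : IsFundamental b ϖ) (i : b.support) :
    Q.coxeter⁻¹ (Q.gam ϖ i) ∉ posRoots b := by
  obtain ⟨u, v, h⟩ := Q.exists_coxeterWord_eq i
  obtain ⟨-, h2, h3⟩ := notMem_of_coxeterWord_eq h
  have : Q.coxeter⁻¹ (Q.gam ϖ i) = -wordProd b v.reverse (D.root i) := by
    rw [gam_eq_wordProd hϖ h, coxeter_eq, h, wordProd_append, mul_inv_rev, LinearEquiv.mul_apply,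
      ← LinearEquiv.mul_apply (wordProd b u)⁻¹, inv_mul_cancel, wordProd_cons, mul_inv_rev,
      wordProd_inv b v]
    simp
  rw [this]
  exact neg_notMem_of_pos (hϖ.wordProd_pos (List.nodup_reverse.2 (List.nodup_append.1 h3).1)
    (by simpa using h2))

theorem coxeter_pow_succ_weight (n : ℕ) (i : b.support) :
    (Q.coxeter ^ (n + 1)) (ϖ i) = (Q.coxeter ^ n) (ϖ i) - (Q.coxeter ^ n) (Q.gam ϖ i) := by
  rw [gam, map_sub, sub_sub_cancel, pow_succ]
  rfl

/-- An adapted word acts on fundamental weights through powers of the Coxeter element. -/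
theorem wordProd_weight_of_isAdapted (hϖ : IsFundamental b ϖ) {w : List b.support}
    (hw : IsAdapted b Q.height w) (i : b.support) :
    wordProd b w (ϖ i) = (Q.coxeter ^ w.count i) (ϖ i) := by
  induction w using List.reverseRecOn generalizing i with
  | nil => simp
  | append_singleton w k ih =>
    have hw' := isAdapted_append.1 hw
    rw [wordProd_append, LinearEquiv.mul_apply, List.count_append, List.count_singleton,
      wordProd_cons, wordProd_nil, mul_one]
    by_cases hki : k = i
    swap
    · rw [hϖ.simpleRefl_ne hki, ih hw'.1]
      simp [hki]
    subst hki
    rw [hϖ.simpleRefl_self, map_sub, ih hw'.1]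
    simp only [beq_self_eq_true, if_true]
    rw [coxeter_pow_succ_weight, sub_right_inj]
    obtain ⟨u, v, h⟩ := Q.exists_coxeterWord_eq k
    obtain ⟨hu, hv, -⟩ := notMem_of_coxeterWord_eq h
    rw [gam_eq_wordProd hϖ h, ← LinearEquiv.mul_apply]
    -- Both sides are Weyl group elements applied to `α_k`, so only the weights of `k` and its
    -- neighbours have to be compared; on these the induction hypothesis evaluates `w`.
    refine hϖ.weyl_apply_eq (wordProd_mem_weyl b w)
      (mul_mem (Q.coxeter_pow_mem _) (wordProd_mem_weyl b u)) fun j hj => ?_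
    rw [ih hw'.1, LinearEquiv.mul_apply]
    by_cases hkj : k = j
    · subst hkj
      rw [hϖ.wordProd_of_notMem hu]
    have hadj : (dynkinGraph b).Adj k j := by
      by_contra hn
      exact hj (by rw [D.root_coroot'_eq_pairing, pairing_eq_zero_of_not_adj b hkj hn])
    have h1 := (abs_eq zero_le_one).1 (Q.abs_height_sub k j hadj)
    have h2 := hw'.2.1 j hadj
    -- Since `k` is a source after `w`, the neighbour `j` is then exactly one lower. So `j` has been
    -- fired once more often than `k` if it began higher, and equally often otherwise.
    have h3 := (abs_eq zero_le_one).1 (IsHeight.fires Q.abs_height_sub hw'.1 k j hadj)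
    rw [fires_apply, fires_apply] at h2 h3
    by_cases hlt : Q.height k < Q.height j
    · rw [← coxeter_apply_of_mem_left hϖ h (mem_left_of_coxeterWord_eq h hadj hlt),
        ← LinearEquiv.mul_apply, ← pow_succ]
      congr 2
      omega
    · have hju : j ∉ u := fun hju => by
        have := mem_right_of_coxeterWord_eq h hadj (by omega)
        exact (List.nodup_append.1 (notMem_of_coxeterWord_eq h).2.2).2.2 j this j hju rfl
      rw [hϖ.wordProd_of_notMem hju]
      congr 2
      omega

theorem beta_of_isAdapted (hϖ : IsFundamental b ϖ) {u v : List b.support} {i : b.support}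
    (h : IsAdapted b Q.height (u ++ i :: v)) :
    wordProd b u (D.root i) = (Q.coxeter ^ u.count i) (Q.gam ϖ i) := by
  have h' : IsAdapted b Q.height (u ++ [i]) := by
    rw [isAdapted_append] at h ⊢
    exact ⟨h.1, h.2.1, trivial⟩
  have h1 := wordProd_weight_of_isAdapted hϖ h' i
  have h2 := wordProd_weight_of_isAdapted hϖ (isAdapted_append.1 h').1 i
  rw [wordProd_append, LinearEquiv.mul_apply, List.count_append, List.count_singleton_self,
    coxeter_pow_succ_weight, wordProd_cons, wordProd_nil, mul_one, hϖ.simpleRefl_self, map_sub,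
    h2, sub_right_inj] at h1
  exact h1

/-- The difference of the two weights telescopes to the sum of the positive roots `τ ^ k γ_i`, `m ≤
k < n`; a `ϖ j` that detects the first summand detects the sum. -/
theorem exists_bil_weight_sub_pos (hϖ : IsFundamental b ϖ) {i : b.support} {m n : ℕ}
    (hmn : m < n)
    (hpos : ∀ k, m ≤ k → k < n → (Q.coxeter ^ k) (Q.gam ϖ i) ∈ posRoots b) :
    ∃ j, bil D ((Q.coxeter ^ n) (ϖ i)) (ϖ j) < bil D ((Q.coxeter ^ m) (ϖ i)) (ϖ j) := by
  obtain ⟨j, hj⟩ := hϖ.exists_bil_pos (hpos m le_rfl hmn)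
  refine ⟨j, ?_⟩
  induction n, Nat.succ_le_iff.2 hmn using Nat.le_induction with
  | base =>
    rw [coxeter_pow_succ_weight, map_sub, LinearMap.sub_apply]
    omega
  | succ n hn ih =>
    have h1 := hϖ.bil_nonneg_of_pos (hpos n (by omega) (by omega)) j
    have h2 := ih (by omega) fun k h1 h2 => hpos k h1 (by omega)
    rw [coxeter_pow_succ_weight, map_sub, LinearMap.sub_apply]
    omega

theorem exists_coxeter_pow_fix (Q : DynkinQuiver b) :
    ∃ m > 0, ∀ x ∈ range D.root, (Q.coxeter ^ m) x = x := by
  let f : ℕ → ι → range D.root := fun n k =>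
    ⟨(Q.coxeter ^ n) (D.root k), weyl_apply_mem_range_root (Q.coxeter_pow_mem n) ⟨k, rfl⟩⟩
  obtain ⟨a, c, hac, hf⟩ := Finite.exists_ne_map_eq_of_infinite f
  wlog h : a < c generalizing a c
  · exact this c a hac.symm hf.symm (by omega)
  refine ⟨c - a, by omega, ?_⟩
  rintro _ ⟨k, rfl⟩
  have h1 := congrArg Subtype.val (congrFun hf k)
  simp only [f] at h1
  rw [show c = a + (c - a) by omega, pow_add, LinearEquiv.mul_apply] at h1
  exact ((Q.coxeter ^ a).injective h1).symm

theorem exists_coxeter_pow_gam_notMem (hϖ : IsFundamental b ϖ) (i : b.support) :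
    ∃ n, (Q.coxeter ^ n) (Q.gam ϖ i) ∉ posRoots b := by
  by_contra! hc
  obtain ⟨m, hm, hfix⟩ := Q.exists_coxeter_pow_fix
  obtain ⟨j, hj⟩ := exists_bil_weight_sub_pos hϖ hm fun k _ _ => hc k
  -- `τ ^ m` fixes every root, so by invariance `ϖ i` and its image pair equally with all roots.
  -- This contradicts the strict inequality `hj`.
  have hz : ∀ k, D.coroot' k (ϖ i - (Q.coxeter ^ m) (ϖ i)) = 0 := fun k => by
    have h1 := two_mul_bil_root (D := D) k (ϖ i - (Q.coxeter ^ m) (ϖ i))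
    have h2 := bil_weyl (Q.coxeter_pow_mem m) (D.root k) (ϖ i)
    rw [hfix _ ⟨k, rfl⟩] at h2
    rw [map_sub, h2, sub_self, mul_zero] at h1
    exact (mul_eq_zero.1 h1.symm).resolve_left (bil_root_self_pos k).ne'
  have := bil_eq_zero_of_coroot'_eq_zero hz (ϖ j)
  rw [map_sub, bil_comm, bil_comm (ϖ j)] at this
  rw [pow_zero] at hj
  change _ < bil D (ϖ i) (ϖ j) at hj
  omega

/-- The number of vertices of `Γ_Q` with first coordinate `i`. -/
def orbitLength (Q : DynkinQuiver b) (ϖ : b.support → M) (i : b.support) : ℕ :=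
  sInf {n | (Q.coxeter ^ n) (Q.gam ϖ i) ∉ posRoots b}

theorem coxeter_pow_orbitLength_notMem (hϖ : IsFundamental b ϖ) (i : b.support) :
    (Q.coxeter ^ Q.orbitLength ϖ i) (Q.gam ϖ i) ∉ posRoots b :=
  Nat.sInf_mem (s := {n | (Q.coxeter ^ n) (Q.gam ϖ i) ∉ posRoots b})
    (exists_coxeter_pow_gam_notMem hϖ i)

theorem coxeter_pow_pos_of_lt {i : b.support} {n : ℕ} (h : n < Q.orbitLength ϖ i) :
    (Q.coxeter ^ n) (Q.gam ϖ i) ∈ posRoots b := by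
  by_contra hn
  exact Nat.notMem_of_lt_sInf h hn

theorem orbitLength_le {i : b.support} {n : ℕ}
    (h : (Q.coxeter ^ n) (Q.gam ϖ i) ∉ posRoots b) : Q.orbitLength ϖ i ≤ n := Nat.sInf_le h

theorem orbitLength_pos (hϖ : IsFundamental b ϖ) (i : b.support) : 0 < Q.orbitLength ϖ i := by
  refine Nat.pos_of_ne_zero fun h => ?_
  have := coxeter_pow_orbitLength_notMem (Q := Q) hϖ i
  rw [h] at this
  exact this (gam_pos hϖ i)

/-- The final height function of an adapted reduced word of the longest element. -/
def finalHeight (Q : DynkinQuiver b) (ϖ : b.support → M) (i : b.support) : ℤ :=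
  Q.height i - 2 * (Q.orbitLength ϖ i : ℤ)

variable [D.IsReduced]

/-- The inversions of `τ` are the roots `β` of the reversed Coxeter word, and `τ` sends the one at
the letter `k` to `-γ_k`. -/
theorem exists_coxeter_eq_neg_gam (hϖ : IsFundamental b ϖ) {x : M} (hx : x ∈ posRoots b)
    (hn : Q.coxeter x ∉ posRoots b) : ∃ k, Q.coxeter x = -Q.gam ϖ k := by
  obtain ⟨u, i, v, h, rfl⟩ := exists_beta_eq (w := Q.coxeterWord.reverse) hx (by
    rwa [wordProd_inv, List.reverse_reverse])
  have h' : Q.coxeterWord = v.reverse ++ i :: u.reverse := by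
    rw [← List.reverse_reverse Q.coxeterWord, h]; simp
  refine ⟨i, ?_⟩
  rw [gam_eq_wordProd hϖ h', coxeter_eq, h', wordProd_append, wordProd_cons, ← wordProd_inv b u,
    LinearEquiv.mul_apply, LinearEquiv.mul_apply, ← LinearEquiv.mul_apply (wordProd b u)⁻¹,
    inv_mul_cancel]
  simp

/-- At the end of its `τ`-orbit, a fundamental weight becomes the negative of a fundamental
weight, up to vectors orthogonal to the roots. -/
theorem exists_bil_orbitLength (hϖ : IsFundamental b ϖ) (j : b.support) :
    ∃ k, ∀ x, bil D x ((Q.coxeter ^ Q.orbitLength ϖ j) (ϖ j)) = -bil D x (ϖ k) := by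
  obtain ⟨n, hn⟩ := Nat.exists_eq_add_of_lt (orbitLength_pos (Q := Q) hϖ j)
  rw [zero_add] at hn
  have h1 := coxeter_pow_orbitLength_notMem (Q := Q) hϖ j
  have h2 : (Q.coxeter ^ n) (Q.gam ϖ j) ∈ posRoots b := coxeter_pow_pos_of_lt (by omega)
  obtain ⟨k, hk⟩ := exists_coxeter_eq_neg_gam hϖ h2 (by
    rw [hn, pow_succ'] at h1; exact h1)
  refine ⟨k, fun x => ?_⟩
  -- Applying `τ` subtracts `τ ^ (n + 1) γ_j` from the first summand and `γ_k` from the second.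
  -- These are opposite, so `τ` fixes `z`, and a `τ`-fixed vector is orthogonal to all roots.
  set z := (Q.coxeter ^ (n + 1)) (ϖ j) + ϖ k with hz
  have hfix : wordProd b Q.coxeterWord z = z := by
    have e1 : Q.coxeter ((Q.coxeter ^ (n + 1)) (ϖ j)) =
        (Q.coxeter ^ (n + 1)) (ϖ j) - Q.coxeter ((Q.coxeter ^ n) (Q.gam ϖ j)) := by
      rw [← LinearEquiv.mul_apply, ← pow_succ', coxeter_pow_succ_weight, pow_succ' _ n]
      rfl
    have e2 : Q.coxeter (ϖ k) = ϖ k - Q.gam ϖ k := by rw [gam, sub_sub_cancel]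
    rw [← coxeter_eq, hz, map_add, e1, e2, hk]
    abel
  have h0 := bil_eq_zero_of_coroot'_eq_zero (coroot'_eq_zero_of_simple b fun i =>
    hϖ.coroot'_eq_zero_of_fixed Q.coxeterWord_nodup hfix i (Q.mem_coxeterWord i)) x
  rw [hz, map_add] at h0
  rw [hn]
  omega

theorem isHeight_finalHeight (hϖ : IsFundamental b ϖ) : IsHeight b (Q.finalHeight ϖ) := by
  have key : ∀ i j, (dynkinGraph b).Adj i j →
      (Q.height i < Q.height j → Q.orbitLength ϖ i ≤ Q.orbitLength ϖ j) ∧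
      (Q.height j < Q.height i → Q.orbitLength ϖ i ≤ Q.orbitLength ϖ j + 1) := by
    intro i j hij
    obtain ⟨k, hk⟩ := exists_bil_orbitLength (Q := Q) hϖ j
    obtain ⟨u, v, h⟩ := Q.exists_coxeterWord_eq i
    obtain ⟨hu, hv, hn⟩ := notMem_of_coxeterWord_eq h
    -- Applying `τ ^ n_j` to both arguments turns the positive pairing with `ϖ j` into a negative
    -- pairing with `ϖ k`, so `τ ^ (n_j + n) γ_i` is not positive.
    have key2 : ∀ n, 0 < bil D ((Q.coxeter ^ n) (Q.gam ϖ i)) (ϖ j) →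
        Q.orbitLength ϖ i ≤ Q.orbitLength ϖ j + n := by
      intro n hpos
      refine orbitLength_le (hϖ.notMem_of_bil_neg (j := k) ?_)
      have h1 := hk ((Q.coxeter ^ (Q.orbitLength ϖ j + n)) (Q.gam ϖ i))
      rw [pow_add, LinearEquiv.mul_apply, bil_weyl (Q.coxeter_pow_mem _)] at h1
      rw [pow_add, LinearEquiv.mul_apply]
      omega
    refine ⟨fun hlt => key2 0 ?_, fun hlt => key2 1 ?_⟩
    · rw [pow_zero, gam_eq_wordProd hϖ h]
      exact hϖ.bil_wordProd_pos_of_adj (List.nodup_append.1 hn).2.1 hu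
        (mem_left_of_coxeterWord_eq h hij hlt) hij
    · have hjv := mem_right_of_coxeterWord_eq h hij hlt
      have hju : j ∉ u := fun hju => (List.nodup_append.1 hn).2.2 j hjv j hju rfl
      have e : (Q.coxeter ^ 1) (Q.gam ϖ i) =
          wordProd b (u ++ [i]) (wordProd b (v ++ u) (D.root i)) := by
        rw [pow_one, gam_eq_wordProd hϖ h, coxeter_eq, h]
        simp [wordProd_append]
      rw [e, hϖ.bil_wordProd_of_notMem (by simp [hju, hij.ne.symm])]
      exact hϖ.bil_wordProd_pos_of_adj hn (by simp [hu, hv]) (by simp [hjv]) hij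
  intro i j hij
  have h1 := (abs_eq zero_le_one).1 (Q.abs_height_sub i j hij)
  have h2 := key i j hij
  have h3 := key j i hij.symm
  rw [abs_eq zero_le_one, finalHeight, finalHeight]
  omega

end DynkinQuiver

end Coxeter

/-! ### Identification of `Γ_Q` with adapted reduced expressions and their quivers. -/

section AR

open scoped Classical

variable {ι M N : Type*} [Finite ι] [AddCommGroup M] [AddCommGroup N] {D : RootPairing ι ℤ M N}
  {b : D.Base} {ϖ : b.support → M}

namespace DynkinQuiver

variable {Q : DynkinQuiver b}

theorem phi_of_le {x : b.support × ℤ} {n : ℕ} (h : Q.height x.1 - x.2 = 2 * n) :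
    Q.phi ϖ x = Q.stepDown^[n] (Q.gam ϖ x.1, 0) := by
  have : (Q.height x.1 - x.2) / 2 = Int.ofNat n := by
    simp only [Int.ofNat_eq_natCast]; omega
  rw [phi, this]

theorem phi_of_lt {x : b.support × ℤ} {n : ℕ} (h : Q.height x.1 - x.2 = -2 * (n + 1)) :
    Q.phi ϖ x = Q.stepUp^[n + 1] (Q.gam ϖ x.1, 0) := by
  have : (Q.height x.1 - x.2) / 2 = Int.negSucc n := by
    rw [Int.negSucc_eq]; omega
  rw [phi, this]

theorem stepDown_snd_le (x : M × ℤ) : (Q.stepDown x).2 ≤ x.2 := by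
  rw [stepDown]; split_ifs <;> simp

theorem le_stepUp_snd (x : M × ℤ) : x.2 ≤ (Q.stepUp x).2 := by
  rw [stepUp]; split_ifs <;> simp

theorem stepDown_iterate_of_lt {i : b.support} {n : ℕ} (h : n < Q.orbitLength ϖ i) :
    Q.stepDown^[n] (Q.gam ϖ i, 0) = ((Q.coxeter ^ n) (Q.gam ϖ i), 0) := by
  induction n with
  | zero => rfl
  | succ n ih =>
    have h1 : Q.coxeter ((Q.coxeter ^ n) (Q.gam ϖ i)) = (Q.coxeter ^ (n + 1)) (Q.gam ϖ i) := by
      rw [pow_succ']; rfl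
    rw [Function.iterate_succ_apply', ih (by omega), stepDown, h1, if_pos]
    exact coxeter_pow_pos_of_lt h

theorem stepDown_iterate_snd_neg (hϖ : IsFundamental b ϖ) {i : b.support} {n : ℕ}
    (h : Q.orbitLength ϖ i ≤ n) : (Q.stepDown^[n] (Q.gam ϖ i, 0)).2 < 0 := by
  induction n, h using Nat.le_induction with
  | base =>
    obtain ⟨n, hn⟩ := Nat.exists_eq_add_of_lt (orbitLength_pos (Q := Q) hϖ i)
    rw [zero_add] at hn
    have h1 : Q.coxeter ((Q.coxeter ^ n) (Q.gam ϖ i)) = (Q.coxeter ^ (n + 1)) (Q.gam ϖ i) := by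
      rw [pow_succ']; rfl
    have h2 := coxeter_pow_orbitLength_notMem (Q := Q) hϖ i
    rw [hn] at h2
    rw [hn, Function.iterate_succ_apply', stepDown_iterate_of_lt (by omega), stepDown, h1,
      if_neg h2]
    simp
  | succ n _ ih =>
    rw [Function.iterate_succ_apply']
    exact (stepDown_snd_le _).trans_lt ih

theorem stepUp_iterate_snd_pos (hϖ : IsFundamental b ϖ) (i : b.support) (n : ℕ) :
    0 < (Q.stepUp^[n + 1] (Q.gam ϖ i, 0)).2 := by
  induction n with
  | zero =>
    rw [zero_add, Function.iterate_one, stepUp, if_neg (coxeter_inv_gam_notMem hϖ i)]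
    simp
  | succ n ih =>
    rw [Function.iterate_succ_apply']
    exact ih.trans_le (le_stepUp_snd _)

/-- The second component of `phi` is monotone along each row. It drops below `0` at step `n_i`
downwards, and already exceeds `0` at the first step upwards because `τ⁻¹ γ_i` is not positive. -/
theorem arVertices_eq (hϖ : IsFundamental b ϖ) :
    Q.arVertices ϖ = between b Q.height (Q.finalHeight ϖ) := by
  ext x
  simp only [arVertices, repVertices, mem_ofPred_eq, mem_prod, mem_singleton_iff, mem_between,
    finalHeight]
  rcases le_or_gt x.2 (Q.height x.1) with hle | hlt
  · constructor
    · rintro ⟨he, -, h2⟩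
      refine ⟨?_, hle, even_neg.1 (by simpa using he)⟩
      by_contra hn
      obtain ⟨c, hc⟩ := he
      obtain ⟨n, hn'⟩ := Int.eq_ofNat_of_zero_le (a := -c) (by omega)
      rw [phi_of_le (n := n) (by omega)] at h2
      exact (stepDown_iterate_snd_neg hϖ (by omega)).ne h2
    · rintro ⟨h1, -, he⟩
      refine ⟨even_neg.1 (by simpa using he), ?_⟩
      obtain ⟨c, hc⟩ := he
      obtain ⟨n, rfl⟩ := Int.eq_ofNat_of_zero_le (a := c) (by omega)
      have hn : n < Q.orbitLength ϖ x.1 := by omega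
      rw [phi_of_le (n := n) (by omega), stepDown_iterate_of_lt hn]
      exact ⟨coxeter_pow_pos_of_lt hn, rfl⟩
  · constructor
    · rintro ⟨he, -, h2⟩
      obtain ⟨c, hc⟩ := he
      obtain ⟨n, hn⟩ := Int.eq_ofNat_of_zero_le (a := c - 1) (by omega)
      rw [phi_of_lt (n := n) (by omega)] at h2
      exact absurd h2 (stepUp_iterate_snd_pos hϖ _ n).ne'
    · rintro ⟨-, h, -⟩
      omega

theorem finalHeight_le (i : b.support) : Q.finalHeight ϖ i ≤ Q.height i := by
  rw [finalHeight]; omega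

theorem even_height_sub_finalHeight (i : b.support) :
    Even (Q.height i - Q.finalHeight ϖ i) := by
  simp [finalHeight]

theorem fires_eq_finalHeight_iff {w : List b.support} :
    fires b Q.height w = Q.finalHeight ϖ ↔ ∀ i, w.count i = Q.orbitLength ϖ i := by
  rw [funext_iff]
  refine forall_congr' fun i => ?_
  rw [fires_apply, finalHeight]
  omega

variable [D.IsReduced]

theorem mem_adaptedExprs_of_fires_eq (hϖ : IsFundamental b ϖ) {w₀ : M ≃ₗ[ℤ] M}
    (h₀ : IsLongest b w₀) {w : List b.support} (hw : IsAdapted b Q.height w)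
    (hf : fires b Q.height w = Q.finalHeight ϖ) : w ∈ Q.adaptedExprs w₀ := by
  rw [fires_eq_finalHeight_iff] at hf
  refine ⟨isReducedExpr_iff.2 ⟨?_, ?_⟩, hw⟩
  · refine h₀.eq_of_apply_notMem hϖ (wordProd_mem_weyl b w) fun k => ?_
    obtain ⟨j, hj⟩ := exists_bil_orbitLength (Q := Q) hϖ k
    -- Modulo vectors orthogonal to the roots, `w` sends `ϖ k` to `-ϖ j`. Invariance turns the
    -- positive pairing of `α_k` with `ϖ k` into a negative one of `w α_k` with `ϖ j`.
    have h1 := hj (wordProd b w (D.root k))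
    rw [← hf, ← wordProd_weight_of_isAdapted hϖ hw, bil_wordProd] at h1
    refine hϖ.notMem_of_bil_neg (j := j) ?_
    have := hϖ.bil_simple_self k
    omega
  · rintro u i v rfl
    rw [beta_of_isAdapted hϖ hw]
    refine coxeter_pow_pos_of_lt ?_
    rw [← hf, List.count_append, List.count_cons_self]
    omega

theorem exists_adapted (hϖ : IsFundamental b ϖ) :
    ∃ w, IsAdapted b Q.height w ∧ fires b Q.height w = Q.finalHeight ϖ :=
  exists_adapted_fires_eq Q.abs_height_sub (isHeight_finalHeight hϖ) finalHeight_le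
    even_height_sub_finalHeight

theorem fires_eq_of_mem_adaptedExprs (hϖ : IsFundamental b ϖ) {w₀ : M ≃ₗ[ℤ] M}
    (h₀ : IsLongest b w₀) {w : List b.support} (hw : w ∈ Q.adaptedExprs w₀) :
    fires b Q.height w = Q.finalHeight ϖ := by
  obtain ⟨w', hw', hf'⟩ := exists_adapted (Q := Q) hϖ
  have h1 := (mem_adaptedExprs_of_fires_eq hϖ h₀ hw' hf').1.1
  rw [fires_eq_finalHeight_iff] at hf' ⊢
  intro i
  have h2 := wordProd_weight_of_isAdapted hϖ hw' i
  have h3 := wordProd_weight_of_isAdapted hϖ hw.2 i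
  rw [h1] at h2
  rw [hw.1.1, h2, hf'] at h3
  -- The occurrence of `i` preceded by `k` others has root `τ ^ k γ_i`, positive because `w` is
  -- reduced.
  have hpos : ∀ k < w.count i, (Q.coxeter ^ k) (Q.gam ϖ i) ∈ posRoots b := by
    intro k
    have hall := hw.1.allBetaPos
    have hadp := hw.2
    clear h3 h1 hw
    induction w using List.reverseRecOn with
    | nil => simp
    | append_singleton w j ih =>
      intro hk
      rcases lt_or_ge k (w.count i) with hlt | hge
      · exact ih (allBetaPos_concat.1 hall).1 (isAdapted_append.1 hadp).1 hlt
      · rw [List.count_append, List.count_singleton] at hk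
        by_cases hji : j = i
        · subst hji
          obtain rfl : k = w.count j := by simp at hk; omega
          rw [← beta_of_isAdapted hϖ hadp]
          exact (allBetaPos_concat.1 hall).2
        · simp [hji] at hk; omega
  rcases lt_trichotomy (w.count i) (Q.orbitLength ϖ i) with h | h | h
  · obtain ⟨j, hj⟩ := exists_bil_weight_sub_pos hϖ h fun k _ hk => coxeter_pow_pos_of_lt hk
    rw [h3] at hj
    exact absurd hj (lt_irrefl _)
  · exact h
  · obtain ⟨j, hj⟩ := exists_bil_weight_sub_pos hϖ h fun k _ hk => hpos k hk
    rw [h3] at hj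
    exact absurd hj (lt_irrefl _)

end DynkinQuiver

theorem eq_take_append (w : List b.support) (k : Fin w.length) :
    w = w.take k ++ w.get k :: w.drop (k + 1) := by
  simp

theorem take_eq_take_append (w : List b.support) {k l : Fin w.length} (h : l < k) :
    w.take k = w.take l ++ w.get l :: (w.take k).drop (l + 1) := by
  have := eq_take_append (w.take k) ⟨l, by simp [Fin.lt_def.1 h]⟩
  simpa [List.take_take, min_eq_left (Fin.lt_def.1 h).le] using this

theorem AllBetaPos.beta_injective [D.IsReduced] {w : List b.support} (hw : AllBetaPos b w) :
    Function.Injective (beta b w) := by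
  have key : ∀ k l, l < k → beta b w k ≠ beta b w l := by
    intro k l h e
    have h1 := eq_take_append w k
    rw [take_eq_take_append w h] at h1
    rw [h1] at hw
    refine hw.beta_ne ?_
    rw [← take_eq_take_append w h]
    exact e
  intro k l e
  rcases lt_trichotomy k l with h | h | h
  · exact absurd e.symm (key l k h)
  · exact h
  · exact absurd e (key k l h)

theorem exists_beta_eq_of_isLongest [D.IsReduced] (hϖ : IsFundamental b ϖ) {w₀ : M ≃ₗ[ℤ] M}
    (h₀ : IsLongest b w₀) {w : List b.support} (hw : wordProd b w = w₀) {x : M}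
    (hx : x ∈ posRoots b) : ∃ k, beta b w k = x := by
  obtain ⟨u, i, v, rfl, rfl⟩ := exists_beta_eq (w := w) hx fun h => by
    have := apply_notMem_of_pos hϖ h₀.1 h₀.apply_simpleRoot h
    rw [hw, ← LinearEquiv.mul_apply, mul_inv_cancel] at this
    exact this hx
  exact ⟨⟨u.length, by simp⟩, by simp [beta]⟩

/-- The vertex of the repetition quiver attached to a position of a word. -/
def coordAt (ξ : b.support → ℤ) (w : List b.support) (k : Fin w.length) : b.support × ℤ :=
  (w.get k, fires b ξ (w.take k) (w.get k))

theorem getElem_coordsFrom_eq (ξ : b.support → ℤ) (w : List b.support) (k : Fin w.length) :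
    (coordsFrom b ξ w)[(k : ℕ)]'(by simp) = coordAt ξ w k :=
  getElem_coordsFrom ξ w k k.2

theorem mem_coordsFrom {ξ : b.support → ℤ} {w : List b.support} {x : b.support × ℤ} :
    x ∈ coordsFrom b ξ w ↔ ∃ k, coordAt ξ w k = x := by
  rw [List.mem_iff_getElem]
  constructor
  · rintro ⟨k, hk, rfl⟩
    exact ⟨⟨k, by simpa using hk⟩, (getElem_coordsFrom_eq ξ w ⟨k, by simpa using hk⟩).symm⟩
  · rintro ⟨k, rfl⟩
    exact ⟨k, by simp, getElem_coordsFrom_eq ξ w k⟩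

theorem coordAt_snd_lt {ξ : b.support → ℤ} {w : List b.support} (hw : IsAdapted b ξ w)
    {k l : Fin w.length} (h : l < k)
    (hkl : w.get l = w.get k ∨ (dynkinGraph b).Adj (w.get l) (w.get k)) :
    (coordAt ξ w k).2 < (coordAt ξ w l).2 := by
  have h1 := List.pairwise_iff_getElem.1 (isCompatibleReading_coordsFrom hw).2 l k (by simp)
    (by simp) h
  rw [getElem_coordsFrom_eq, getElem_coordsFrom_eq] at h1
  exact h1 hkl

theorem coordAt_snd_eq_add_one_iff {ξ : b.support → ℤ} {w : List b.support}
    (hw : IsAdapted b ξ w) {k l : Fin w.length}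
    (hadj : (dynkinGraph b).Adj (w.get k) (w.get l)) :
    (coordAt ξ w l).2 = (coordAt ξ w k).2 + 1 ↔
      l < k ∧ ∀ j, l < j → j < k → w.get j ≠ w.get k ∧ w.get j ≠ w.get l := by
  constructor
  · intro h
    refine ⟨?_, fun j hlj hjk => ⟨fun e => ?_, fun e => ?_⟩⟩
    · rcases lt_trichotomy l k with h' | h' | h'
      · exact h'
      · exact absurd (h' ▸ rfl) hadj.ne
      · have := coordAt_snd_lt hw h' (Or.inr hadj)
        omega
    · have h1 := coordAt_snd_lt hw hjk (Or.inl e)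
      have h2 := coordAt_snd_lt hw hlj (Or.inr (e ▸ hadj.symm))
      omega
    · have h1 := coordAt_snd_lt hw hjk (Or.inr (e ▸ hadj.symm))
      have h2 := coordAt_snd_lt hw hlj (Or.inl e.symm)
      omega
  -- Just before position `k`, the letter at `l` has been fired once since its own coordinate was
  -- recorded, and the letter at `k` is a source. So `p_l - 2 < p_k < p_l`.
  · rintro ⟨hlk, hbet⟩
    have h1 := coordAt_snd_lt hw hlk (Or.inr hadj.symm)
    have h2 := hw
    rw [eq_take_append w k, isAdapted_append] at h2
    have h3 := h2.2.1 _ hadj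
    have hnot : w.get l ∉ (w.take k).drop (l + 1) := fun hm => by
      obtain ⟨n, hn, e⟩ := List.mem_iff_getElem.1 hm
      simp only [List.length_drop, List.length_take] at hn
      rw [List.getElem_drop, List.getElem_take] at e
      exact (hbet ⟨l + 1 + n, by omega⟩ (Fin.lt_def.2 (by simp only; omega))
        (Fin.lt_def.2 (by simp only; omega))).2 e
    have h4 : fires b ξ (w.take k) (w.get l) = fires b ξ (w.take l) (w.get l) - 2 := by
      rw [take_eq_take_append w hlk, fires_append, fires_cons, fires_of_notMem _ hnot, fire_apply,
        if_pos rfl]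
    simp only [coordAt] at h1 ⊢
    omega

/-- Injectivity of `beta b w` makes the positions stored in an arrow unique. The `Nonempty` form
lets the values of `phi` be rewritten in the goal before an equivalence is chosen. -/
theorem nonempty_arrow_equiv [D.IsReduced] {ξ : b.support → ℤ} {w : List b.support}
    (hw : IsAdapted b ξ w) (hpos : AllBetaPos b w) (k l : Fin w.length) :
    Nonempty (RepArrow b (coordAt ξ w k) (coordAt ξ w l) ≃
      UpsArrow b w (beta b w k) (beta b w l)) := by
  by_cases hadj : (dynkinGraph b).Adj (w.get k) (w.get l)
  swap
  · have : IsEmpty (RepArrow b (coordAt ξ w k) (coordAt ξ w l)) := ⟨fun a => hadj a.adj⟩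
    have : IsEmpty (UpsArrow b w (beta b w k) (beta b w l)) := ⟨fun a => by
      have h1 := hpos.beta_injective a.source_eq
      have h2 := hpos.beta_injective a.target_eq
      have h3 := a.adj
      rw [h1, h2] at h3
      exact hadj h3⟩
    exact ⟨Equiv.equivOfIsEmpty _ _⟩
  have hiff := coordAt_snd_eq_add_one_iff hw hadj
  by_cases hs : (coordAt ξ w l).2 = (coordAt ξ w k).2 + 1
  swap
  · have : IsEmpty (RepArrow b (coordAt ξ w k) (coordAt ξ w l)) := ⟨fun a => hs a.snd_eq⟩
    have : IsEmpty (UpsArrow b w (beta b w k) (beta b w l)) := ⟨fun a => by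
      have h1 := hpos.beta_injective a.source_eq
      have h2 := hpos.beta_injective a.target_eq
      have h3 := a.lt
      have h4 := a.between
      rw [h1, h2] at h3 h4
      exact hs (hiff.2 ⟨h3, h4⟩)⟩
    exact ⟨Equiv.equivOfIsEmpty _ _⟩
  obtain ⟨hlt, hbet⟩ := hiff.1 hs
  refine ⟨Equiv.ofBijective (fun a => ⟨k, l, rfl, rfl, hlt, hadj, hbet, a.copy⟩) ⟨?_, ?_⟩⟩
  · rintro ⟨_, _, c⟩ ⟨_, _, c'⟩ h
    cases h
    rfl
  · rintro ⟨k', l', h1, h2, h3, h4, h5, c⟩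
    obtain rfl := hpos.beta_injective h1
    obtain rfl := hpos.beta_injective h2
    exact ⟨⟨hadj, hs, c⟩, rfl⟩

namespace DynkinQuiver

variable {Q : DynkinQuiver b}

theorem phi_coordAt (hϖ : IsFundamental b ϖ) {w : List b.support}
    (hw : IsAdapted b Q.height w) (hf : fires b Q.height w = Q.finalHeight ϖ)
    (k : Fin w.length) : Q.phi ϖ (coordAt Q.height w k) = (beta b w k, 0) := by
  rw [fires_eq_finalHeight_iff] at hf
  have h1 := hf (w.get k)
  rw [eq_take_append w k] at hw
  rw [congrArg (List.count (w.get k)) (eq_take_append w k), List.count_append,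
    List.count_cons_self] at h1
  rw [phi_of_le (n := (w.take k).count (w.get k)) (by simp only [coordAt, fires_apply]; ring),
    beta, beta_of_isAdapted hϖ hw]
  exact stepDown_iterate_of_lt (i := w.get k) (by omega)

theorem exists_quiverIso [D.IsReduced] (hϖ : IsFundamental b ϖ) {w₀ : M ≃ₗ[ℤ] M}
    (h₀ : IsLongest b w₀) {w : List b.support} (hw : w ∈ Q.adaptedExprs w₀) :
    ∃ e : QuiverIso (Gam Q ϖ) (Ups b w),
      ∀ x : Gam Q ϖ, (((e.vertex x).1 : M), (0 : ℤ)) = Q.phi ϖ x.1 := by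
  have hf := fires_eq_of_mem_adaptedExprs hϖ h₀ hw
  have hpos := hw.1.allBetaPos
  have hphi := phi_coordAt hϖ hw.2 hf
  have hmem : ∀ x, x ∈ Q.arVertices ϖ ↔ ∃ k, coordAt Q.height w k = x := fun x => by
    rw [arVertices_eq hϖ, ← hf, ← (isCompatibleReading_coordsFrom hw.2).1, mem_coordsFrom]
  let f : Gam Q ϖ → Ups b w := fun x => ⟨(Q.phi ϖ x.1).1, x.2.2.1⟩
  have hfb : Function.Bijective f := by
    constructor
    · rintro ⟨x, hx⟩ ⟨y, hy⟩ h
      obtain ⟨k, rfl⟩ := (hmem x).1 hx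
      obtain ⟨l, rfl⟩ := (hmem y).1 hy
      have h1 : (Q.phi ϖ (coordAt Q.height w k)).1 = (Q.phi ϖ (coordAt Q.height w l)).1 :=
        congrArg Subtype.val h
      rw [hphi, hphi] at h1
      obtain rfl := hpos.beta_injective h1
      rfl
    · rintro ⟨x, hx⟩
      obtain ⟨k, rfl⟩ := exists_beta_eq_of_isLongest hϖ h₀ hw.1.1 hx
      exact ⟨⟨_, (hmem _).2 ⟨k, rfl⟩⟩, Subtype.ext (congrArg Prod.fst (hphi k))⟩
  have harr : ∀ x y : Gam Q ϖ, Nonempty ((x ⟶ y) ≃ (f x ⟶ f y)) := by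
    rintro ⟨x, hx⟩ ⟨y, hy⟩
    obtain ⟨k, rfl⟩ := (hmem x).1 hx
    obtain ⟨l, rfl⟩ := (hmem y).1 hy
    change Nonempty (RepArrow b (coordAt Q.height w k) (coordAt Q.height w l) ≃
      UpsArrow b w (Q.phi ϖ (coordAt Q.height w k)).1 (Q.phi ϖ (coordAt Q.height w l)).1)
    rw [hphi, hphi]
    exact nonempty_arrow_equiv hw.2 hpos k l
  refine ⟨⟨Equiv.ofBijective f hfb, fun x y => (harr x y).some⟩, fun x => ?_⟩
  exact Prod.ext rfl x.2.2.2.symm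

theorem isCommutationClass_adaptedExprs [D.IsReduced] (hϖ : IsFundamental b ϖ)
    {w₀ : M ≃ₗ[ℤ] M} (h₀ : IsLongest b w₀) :
    IsCommutationClass b w₀ (Q.adaptedExprs w₀) := by
  obtain ⟨w, hw, hf⟩ := exists_adapted (Q := Q) hϖ
  have hmem := mem_adaptedExprs_of_fires_eq hϖ h₀ hw hf
  refine ⟨w, hmem.1, Set.ext fun w' => ⟨fun hw' => ?_, fun h => ?_⟩⟩
  · refine commMoves_of_perm hw hw'.2 (List.perm_iff_count.2 fun i => ?_)
    rw [fires_eq_finalHeight_iff.1 hf, fires_eq_finalHeight_iff.1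
      (fires_eq_of_mem_adaptedExprs hϖ h₀ hw')]
  · change Relation.ReflTransGen (CommMove b) w w' at h
    induction h with
    | refl => exact hmem
    | tail _ h ih =>
      exact ⟨⟨h.wordProd_eq.trans ih.1.1, h.length_eq.trans ih.1.2⟩, h.isAdapted ih.2⟩

end DynkinQuiver

end AR

end CombAR

end

/-! ### The correspondence and the quiver isomorphism. -/

theorem mainTheorem6 {ι M N : Type*} [Finite ι] [AddCommGroup M] [AddCommGroup N]
    (D : RootPairing ι ℤ M N) [D.IsReduced] (b : D.Base)
    (hconn : (CombAR.dynkinGraph b).Connected)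
    (ϖ : b.support → M)
    (hϖ_same : ∀ i : b.support, D.coroot' i (ϖ i) = 1)
    (hϖ_ne : ∀ i j : b.support, i ≠ j → D.coroot' j (ϖ i) = 0)
    (w₀ : M ≃ₗ[ℤ] M) (hw₀ : CombAR.IsLongest b w₀)
    (Q : CombAR.DynkinQuiver b) :
    -- a compatible reading gives an adapted reduced expression, with `φ_Q(i_k, p_k) = (β_k, 0)`
    (∀ L : List (b.support × ℤ), CombAR.IsCompatibleReading b (Q.arVertices ϖ) L →
      L.map Prod.fst ∈ Q.adaptedExprs w₀ ∧
      ∀ (k : ℕ) (hk : k < L.length),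
        Q.phi ϖ L[k] = (CombAR.beta b (L.map Prod.fst) ⟨k, by simpa using hk⟩, 0)) ∧
    -- conversely, an adapted reduced expression gives a compatible reading
    (∀ w ∈ Q.adaptedExprs w₀,
      CombAR.IsCompatibleReading b (Q.arVertices ϖ) (Q.coords w) ∧
      ∀ k : Fin w.length,
        Q.phi ϖ ((Q.coords w)[(k : ℕ)]'(by simp [CombAR.DynkinQuiver.coords])) =
          (CombAR.beta b w k, 0)) ∧
    -- the correspondence is one-to-one
    Set.BijOn (List.map Prod.fst) {L | CombAR.IsCompatibleReading b (Q.arVertices ϖ) L}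
      (Q.adaptedExprs w₀) ∧
    -- the adapted reduced expressions form one commutation class `[Q]`
    CombAR.IsCommutationClass b w₀ (Q.adaptedExprs w₀) ∧
    -- and `φ_Q` is a quiver isomorphism onto the combinatorial AR-quiver of `[Q]`
    ∀ w ∈ Q.adaptedExprs w₀, ∃ e : CombAR.QuiverIso (CombAR.Gam Q ϖ) (CombAR.Ups b w),
      ∀ x : CombAR.Gam Q ϖ, (((e.vertex x).1 : M), (0 : ℤ)) = Q.phi ϖ x.1 := by
  have h : CombAR.IsFundamental b ϖ := ⟨hϖ_same, hϖ_ne⟩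
  have key : ∀ L, CombAR.IsCompatibleReading b (Q.arVertices ϖ) L →
      L.map Prod.fst ∈ Q.adaptedExprs w₀ ∧ Q.coords (L.map Prod.fst) = L := by
    intro L hL
    rw [CombAR.DynkinQuiver.arVertices_eq h] at hL
    obtain ⟨h1, h2, h3⟩ := hL.eq_coordsFrom (CombAR.DynkinQuiver.isHeight_finalHeight h)
      CombAR.DynkinQuiver.finalHeight_le CombAR.DynkinQuiver.even_height_sub_finalHeight
    exact ⟨CombAR.DynkinQuiver.mem_adaptedExprs_of_fires_eq h hw₀ h1 h2,
      (CombAR.coords_eq Q _).trans h3⟩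
  have read : ∀ w ∈ Q.adaptedExprs w₀,
      CombAR.IsCompatibleReading b (Q.arVertices ϖ) (Q.coords w) := by
    intro w hw
    rw [CombAR.DynkinQuiver.arVertices_eq h, CombAR.coords_eq,
      ← CombAR.DynkinQuiver.fires_eq_of_mem_adaptedExprs h hw₀ hw]
    exact CombAR.isCompatibleReading_coordsFrom hw.2
  have hphi : ∀ w ∈ Q.adaptedExprs w₀, ∀ k : Fin w.length,
      Q.phi ϖ ((Q.coords w)[(k : ℕ)]'(by simp [CombAR.DynkinQuiver.coords])) =
        (CombAR.beta b w k, 0) := by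
    intro w hw k
    simp only [CombAR.coords_eq, CombAR.getElem_coordsFrom_eq]
    exact CombAR.DynkinQuiver.phi_coordAt h hw.2
      (CombAR.DynkinQuiver.fires_eq_of_mem_adaptedExprs h hw₀ hw) k
  have hmap : ∀ w, (Q.coords w).map Prod.fst = w := fun w => by
    rw [CombAR.coords_eq, CombAR.map_fst_coordsFrom]
  refine ⟨fun L hL => ⟨(key L hL).1, fun k hk => ?_⟩, fun w hw => ⟨read w hw, hphi w hw⟩,
    ⟨fun L hL => (key L hL).1, fun L hL L' hL' e => ?_,
      fun w hw => ⟨Q.coords w, read w hw, hmap w⟩⟩,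
    CombAR.DynkinQuiver.isCommutationClass_adaptedExprs h hw₀,
    fun w hw => CombAR.DynkinQuiver.exists_quiverIso h hw₀ hw⟩
  · have h1 := hphi _ (key L hL).1 ⟨k, by simpa using hk⟩
    simpa only [(key L hL).2] using h1
  -- A reading is recovered from its letters by `Q.coords`.
  · rw [← (key L hL).2, ← (key L' hL').2, e]
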